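/- All alphabets are finite, logarithms are natural, $0\cdot\infty=0$, $-\log 0=+\infty$. A *message graph* $G(\Delta_1,\Delta_2,\Delta_1',\Delta_2',\mu)$, $\mu>1$, is a bipartite graph with vertex sets of sizes $\Delta_1,\Delta_2$ in which every vertex of the first set has degree between $\Delta_2'\mu^{-1}$ and $\Delta_2'\mu$ and every vertex of the second set has degree between $\Delta_1'\mu^{-1}$ and $\Delta_1'\mu$; its edges are the possible (equally likely) message pairs. **BYP.** A Berger–Yeung problem with correlated messages consists of a source $\bar p(x_1,x_2)$ on $\mathcal X_1\times\mathcal X_2$, a distortion $d:\mathcal X_1\times\mathcal X_2\times\hat{\mathcal X}_2\to(-\infty,+\infty]$, a constraint $D\in\mathbb R$ and a message graph. Its sum-rate–distortion function is $$R^{sum}_{BYP}(D)=\min\,[H(X_1)+I(V;X_2)-I(X_1;V)]$$ over finite alphabets $\mathcal V$ with $|\mathcal V|\le\kappa_B$ and $p(v|x_2)$, $p(\hat x_2|x_1,v)$, with joint law $\bar p(x_1,x_2)p(v|x_2)p(\hat x_2|x_1,v)$, subject to $Ed\le D$, $X_1\to X_2\to V$ and $X_2\to(X_1,V)\to\hat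 X_2$. **SBC.** A semi-deterministic broadcast channel problem with correlated messages consists of a channel $\bar p(x_2|x)$, a function $x_1=f(x)$, a cost $w:\mathcal X\to(-\infty,+\infty]$, a constraint $W\in\mathbb R$ and a message graph. Its sum-rate–cost function is $$R^{sum}_{SBC}(W)=\max\,[H(X_1)+I(V;X_2)-I(X_1;V)]$$ over finite $\mathcal V$ with $|\mathcal V|\le\kappa_S$ and $p(v)$, $p(x|v)$, with joint law $p(v)p(x|v)\bar p(x_2|x)$, subject to $Ew\le W$, $V\to X\to(X_1,X_2)$ and $X_2\to(X_1,V)\to X$. The caps $\kappa_B,\kappa_S\in\mathbb N\cup\{\infty\}$ are arbitrary, and the auxiliary alphabets of the optimizers $p^*$ below are assumed to obey both. Everything below holds as well if the last Markov conditions are strengthened, in both problems, to $X_2\to V\to(X_1,\hat X_2)$ and $X_2\to V\to X$. At the auxiliary variables of $p^*$, the *rate inequalities* of the BYP are $R_i\ge R_i'\ge0$, $R_1'\ge H(X_1|V)$, $R_2'\ge I(V;X_2|X_1)$, $R_1+R_2'=R_1'+R_2\ge H(X_1)+I(V;X_2|X_1)$; those of the SBC are $R_i\ge R_i'\ge0$,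 $R_1\le H(X_1)$, $R_2\le I(V;X_2)$, $R_1+R_2'=R_1'+R_2\le H(X_1|V)+I(V;X_2)$. Given binned codebooks of strongly $\varepsilon$-typical sequences $x_1^n$ and $v^n$, the *generated graph* joins two bins iff they contain a jointly strongly $\varepsilon$-typical pair for the law of $(X_1,V)$. **Theorem 2.** (1) Given a BYP, let $p^*(v|x_2),p^*(\hat x_2|x_1,v)$ achieve the minimum $R^{sum}_{BYP}(D)$, and let $p^*(x_1,x_2,v,\hat x_2)$ be the induced joint law. Put $X=(X_1,\hat X_2)$ and suppose $V\to X\to(X_1,X_2)$. Let $c_1>0$, $\theta\in\mathbb R$. Then there is an SBC (the dual) with input alphabet $\mathcal X_1\times\hat{\mathcal X}_2$, $f(x_1,\hat x_2)=x_1$, channel (a version of) $p^*(x_2|x_1,\hat x_2)$, the same message graph, cost $$w(x)=c_1D(p^*(x_1,x_2|x)\,\|\,\bar p(x_1,x_2))+\theta$$ (so $w\ge0$ if $\theta\ge0$) and $W=E_{p^*(x)}[w(X)]$. For every such SBC, $R^{sum}_{BYP}(D)=R^{sum}_{SBC}(W)$; the distributions $p^*(v)$, $p^*(x|v)$ (any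 version) achieve the maximum in the SBC; both problems have the same joint law of $(X_1,X_2,V,\hat X_2)$; and the correlation structure of the messages is the same: the message graphs agree, the same binned codebooks generate the same graph in both problems, and the tuples $(R_1,R_2,R_1',R_2')$ with $R_1+R_2'$ equal to the optimal sum-rate which satisfy the rate inequalities are the same. (2) Given an SBC, let $p^*(v),p^*(x|v)$ achieve the maximum $R^{sum}_{SBC}(W)$. Identify each input $x$ with a pair $(x_1,\hat x_2)=(f(x),g(x))$, where $g:\mathcal X\to\hat{\mathcal X}_2$ is any map for which $x\mapsto(f(x),g(x))$ is injective, and let $p^*(v,x_1,\hat x_2,x_2)$ be the induced joint law. Suppose $X_1\to X_2\to V$. Let $c_2>0$ and $d_0:\mathcal X_1\times\mathcal X_2\to\mathbb R$. Then there is a BYP (the dual) with source $p^*(x_1,x_2)$, reconstruction alphabet $\hat{\mathcal X}_2$, the same message graph, distortion $$d(x_1,x_2,\hat x_2)=-c_2\log\bar p(x_2|x)+d_0(x_1,x_2)$$ ($+\infty$ if $(x_1,\hat x_2)$ is not an input; so $d\ge0$ if $d_0\ge0$) and $D=E_{p^*}[d(X_1,X_2,\hat X_2)]$. For every such BYP,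 $R^{sum}_{SBC}(W)=R^{sum}_{BYP}(D)$; the distributions $p^*(v|x_2)$, $p^*(\hat x_2|x_1,v)$ (any versions) achieve the minimum in the BYP; both problems have the same joint law of $(X_1,X_2,V,\hat X_2)$; and the correlation structure of the messages is the same, as in (1). -/

import Mathlib

/-! ### Finite probability and information measures (natural logarithm) -/

/-- The law of the random variable `X` when outcomes `ω` have weight `P ω`. -/
noncomputable def law {Ω α : Type*} [Fintype Ω] (P : Ω → ℝ) (X : Ω → α) : α → ℝ :=
  open Classical in fun a => ∑ ω, if X ω = a then P ω else 0

/-- The family `K a` of weights is a conditional distribution on `β` given `a`. -/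
def IsCondDist {α β : Type*} [Fintype β] (K : α → β → ℝ) : Prop :=
  ∀ a, K a ∈ stdSimplex ℝ β

/-- The Markov chain `A → B → C` under `P`. -/
def IsMarkov {Ω α β γ : Type*} [Fintype Ω] (P : Ω → ℝ)
    (A : Ω → α) (B : Ω → β) (C : Ω → γ) : Prop :=
  ∀ a b c, law P (fun ω => (A ω, B ω, C ω)) (a, b, c) * law P B b
    = law P (fun ω => (A ω, B ω)) (a, b) * law P (fun ω => (B ω, C ω)) (b, c)

/-- Shannon entropy `H(X)`. -/
noncomputable def entropy {Ω α : Type*} [Fintype Ω] [Fintype α] (P : Ω → ℝ) (X : Ω → α) : ℝ :=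
  ∑ a, Real.negMulLog (law P X a)

/-- Conditional entropy `H(X | Y)`. -/
noncomputable def condEntropy {Ω α β : Type*} [Fintype Ω] [Fintype α] [Fintype β]
    (P : Ω → ℝ) (X : Ω → α) (Y : Ω → β) : ℝ :=
  entropy P (fun ω => (X ω, Y ω)) - entropy P Y

/-- Mutual information `I(X ; Y)`. -/
noncomputable def mutualInfo {Ω α β : Type*} [Fintype Ω] [Fintype α] [Fintype β]
    (P : Ω → ℝ) (X : Ω → α) (Y : Ω → β) : ℝ :=
  entropy P X + entropy P Y - entropy P (fun ω => (X ω, Y ω))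

/-- Conditional mutual information `I(X ; Y | Z)`. -/
noncomputable def condMutualInfo {Ω α β γ : Type*} [Fintype Ω] [Fintype α] [Fintype β] [Fintype γ]
    (P : Ω → ℝ) (X : Ω → α) (Y : Ω → β) (Z : Ω → γ) : ℝ :=
  condEntropy P X Z - condEntropy P X (fun ω => (Y ω, Z ω))

/-- The expectation of an extended-real function; outcomes of weight `0` contribute `0`. -/
noncomputable def expect {Ω : Type*} [Fintype Ω] (P : Ω → ℝ) (h : Ω → EReal) : EReal :=
  ∑ ω, (P ω : EReal) * h ω

/-- `-log t`, with `-log 0 = +∞`. -/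
noncomputable def negLog (t : ℝ) : EReal :=
  open Classical in if t = 0 then ⊤ else ((-Real.log t : ℝ) : EReal)

/-- The relative entropy `D(p ‖ q)` of two distributions on a finite set
(`0 log (0 / q) = 0`, and `p log (p / 0) = +∞` for `p > 0`). -/
noncomputable def relEntropy {α : Type*} [Fintype α] (p q : α → ℝ) : EReal :=
  open Classical in
  ∑ a, if p a = 0 then 0 else if q a = 0 then ⊤
    else ((p a * Real.log (p a / q a) : ℝ) : EReal)

/-- `x` is a strongly `ε`-typical sequence for the distribution `q`. -/
def IsTypical {α : Type*} [Fintype α] (q : α → ℝ) (ε : ℝ) {n : ℕ} (x : Fin n → α) : Prop :=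
  ∀ a, |(Nat.card {m : Fin n // x m = a} : ℝ) / n - q a| < ε / Fintype.card α ∧
    (q a = 0 → ∀ m, x m ≠ a)

/-! ### Correlated messages -/

/-- A nearly semi-regular bipartite graph with parameters `(Δ₁, Δ₂, Δ₁', Δ₂', μ)`: the message
pairs in `edges` are the possible ones (and are equally likely). -/
structure MessageGraph where
  Δ₁ : ℕ
  Δ₂ : ℕ
  Δ₁' : ℝ
  Δ₂' : ℝ
  μ : ℝ
  edges : Finset (Fin Δ₁ × Fin Δ₂)
  one_lt_μ : 1 < μ
  deg₁ : ∀ u : Fin Δ₁, Δ₂' * μ⁻¹ ≤ (edges.filter (fun e => e.1 = u)).card ∧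
    ((edges.filter (fun e => e.1 = u)).card : ℝ) ≤ Δ₂' * μ
  deg₂ : ∀ v : Fin Δ₂, Δ₁' * μ⁻¹ ≤ (edges.filter (fun e => e.2 = v)).card ∧
    ((edges.filter (fun e => e.2 = v)).card : ℝ) ≤ Δ₁' * μ

/-- `G` is the graph generated, for a joint distribution `q` of `(X₁, V)`, by the codebooks `c₁`,
`c₂` of typical sequences and their binnings `b₁`, `b₂`: two bins are adjacent if and only if they
contain a jointly typical pair of codewords. -/
def MessageGraph.GeneratedBy (G : MessageGraph) {α β : Type*} [Fintype α] [Fintype β]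
    (q : α × β → ℝ) (ε : ℝ) {n M₁ M₂ : ℕ}
    (c₁ : Fin M₁ → Fin n → α) (c₂ : Fin M₂ → Fin n → β)
    (b₁ : Fin M₁ → Fin G.Δ₁) (b₂ : Fin M₂ → Fin G.Δ₂) : Prop :=
  (∀ k, IsTypical (law q Prod.fst) ε (c₁ k)) ∧
  (∀ l, IsTypical (law q Prod.snd) ε (c₂ l)) ∧
  ∀ i j, (i, j) ∈ G.edges ↔
    ∃ k l, b₁ k = i ∧ b₂ l = j ∧ IsTypical q ε (fun m => (c₁ k m, c₂ l m))

/-! ### The Berger–Yeung problem with correlated messages -/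

/-- A Berger–Yeung problem: source `p̄(x₁,x₂)`, distortion measure (`+∞` is allowed), distortion
constraint, message graph. `Y` is the reconstruction alphabet of `X₂`. -/
structure BYP (X₁ X₂ Y : Type*) [Fintype X₁] [Fintype X₂] where
  source : X₁ × X₂ → ℝ
  source_mem : source ∈ stdSimplex ℝ (X₁ × X₂)
  dist : X₁ → X₂ → Y → EReal
  dist_ne_bot : ∀ x₁ x₂ y, dist x₁ x₂ y ≠ ⊥
  D : ℝ
  graph : MessageGraph

/-- The variables of the optimization: `p(v|x₂)` and `p(x̂₂|x₁,v)`. -/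
structure BYP.Test {X₁ X₂ Y : Type*} [Fintype X₁] [Fintype X₂] [Fintype Y]
    (P : BYP X₁ X₂ Y) (V : Type) [Fintype V] where
  pV : X₂ → V → ℝ
  pY : X₁ × V → Y → ℝ
  pV_cond : IsCondDist pV
  pY_cond : IsCondDist pY

namespace BYP
namespace Test

variable {X₁ X₂ Y : Type*} [Fintype X₁] [Fintype X₂] [Fintype Y]
  {P : BYP X₁ X₂ Y} {V : Type} [Fintype V]

/-- The joint distribution `p̄(x₁,x₂) p(v|x₂) p(x̂₂|x₁,v)` of `(X₁, X₂, V, X̂₂)`. -/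
def joint (t : P.Test V) : X₁ × X₂ × V × Y → ℝ :=
  fun ω => P.source (ω.1, ω.2.1) * t.pV ω.2.1 ω.2.2.1 * t.pY (ω.1, ω.2.2.1) ω.2.2.2

/-- `H(X₁) + I(V;X₂) - I(X₁;V)`. -/
noncomputable def sumRate (t : P.Test V) : ℝ :=
  entropy t.joint (fun ω => ω.1)
    + mutualInfo t.joint (fun ω => ω.2.2.1) (fun ω => ω.2.1)
    - mutualInfo t.joint (fun ω => ω.1) (fun ω => ω.2.2.1)

/-- The constraints: alphabet size at most `cap`, `E d ≤ D`, `X₁ → X₂ → V`,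
`X₂ → (X₁,V) → X̂₂`, and, if `strict` holds, even `X₂ → V → (X₁,X̂₂)`. -/
def Feasible (strict : Prop) (cap : ℕ∞) (t : P.Test V) : Prop :=
  (Fintype.card V : ℕ∞) ≤ cap ∧
  expect t.joint (fun ω => P.dist ω.1 ω.2.1 ω.2.2.2) ≤ (P.D : EReal) ∧
  IsMarkov t.joint (fun ω => ω.1) (fun ω => ω.2.1) (fun ω => ω.2.2.1) ∧
  IsMarkov t.joint (fun ω => ω.2.1) (fun ω => (ω.1, ω.2.2.1)) (fun ω => ω.2.2.2) ∧
  (strict → IsMarkov t.joint (fun ω => ω.2.1) (fun ω => ω.2.2.1) (fun ω => (ω.1, ω.2.2.2)))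

/-- The rate tuple `(R₁, R₂, R₁', R₂')` satisfies the inequalities of the achievable
rate-distortion region for the given `V`. -/
def InRegion (t : P.Test V) (R₁ R₂ R₁' R₂' : ℝ) : Prop :=
  0 ≤ R₁' ∧ R₁' ≤ R₁ ∧ 0 ≤ R₂' ∧ R₂' ≤ R₂ ∧
  condEntropy t.joint (fun ω => ω.1) (fun ω => ω.2.2.1) ≤ R₁' ∧
  condMutualInfo t.joint (fun ω => ω.2.2.1) (fun ω => ω.2.1) (fun ω => ω.1) ≤ R₂' ∧
  R₁ + R₂' = R₁' + R₂ ∧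
  entropy t.joint (fun ω => ω.1)
    + condMutualInfo t.joint (fun ω => ω.2.2.1) (fun ω => ω.2.1) (fun ω => ω.1) ≤ R₁ + R₂'

end Test

variable {X₁ X₂ Y : Type*} [Fintype X₁] [Fintype X₂] [Fintype Y]

/-- The values over which the minimum is taken. -/
def sumRates (strict : Prop) (cap : ℕ∞) (P : BYP X₁ X₂ Y) : Set ℝ :=
  {r | ∃ (V : Type) (_ : Fintype V) (t : P.Test V), t.Feasible strict cap ∧ t.sumRate = r}

/-- The sum-rate–distortion function `R_BYP^sum(D)`. -/
noncomputable def optSumRate (strict : Prop) (cap : ℕ∞) (P : BYP X₁ X₂ Y) : ℝ :=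
  sInf (P.sumRates strict cap)

/-- `t` achieves the minimum. -/
def Test.Optimal {P : BYP X₁ X₂ Y} {V : Type} [Fintype V]
    (strict : Prop) (cap : ℕ∞) (t : P.Test V) : Prop :=
  t.Feasible strict cap ∧ IsLeast (P.sumRates strict cap) t.sumRate

end BYP

/-! ### The semi-deterministic broadcast channel with correlated messages -/

/-- A semi-deterministic broadcast channel problem: `x₁ = f x`, channel `p̄(x₂|x)`, input cost
(`+∞` is allowed), cost constraint, message graph. -/
structure SBC (X X₁ X₂ : Type*) [Fintype X₂] where
  f : X → X₁
  chan : X → X₂ → ℝ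
  chan_cond : IsCondDist chan
  cost : X → EReal
  cost_ne_bot : ∀ x, cost x ≠ ⊥
  W : ℝ
  graph : MessageGraph

/-- The variables of the optimization: `p(v)` and `p(x|v)`. -/
structure SBC.Input {X X₁ X₂ : Type*} [Fintype X] [Fintype X₂]
    (Q : SBC X X₁ X₂) (V : Type) [Fintype V] where
  pV : V → ℝ
  pX : V → X → ℝ
  pV_mem : pV ∈ stdSimplex ℝ V
  pX_cond : IsCondDist pX

namespace SBC
namespace Input

variable {X X₁ X₂ : Type*} [Fintype X] [Fintype X₁] [Fintype X₂]
  {Q : SBC X X₁ X₂} {V : Type} [Fintype V]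

/-- The joint distribution `p(v) p(x|v) p̄(x₂|x)` of `(V, X, X₂)`. -/
def joint (s : Q.Input V) : V × X × X₂ → ℝ :=
  fun ω => s.pV ω.1 * s.pX ω.1 ω.2.1 * Q.chan ω.2.1 ω.2.2

/-- `H(X₁) + I(V;X₂) - I(X₁;V)` with `X₁ = f(X)`. -/
noncomputable def sumRate (s : Q.Input V) : ℝ :=
  entropy s.joint (fun ω => Q.f ω.2.1)
    + mutualInfo s.joint (fun ω => ω.1) (fun ω => ω.2.2)
    - mutualInfo s.joint (fun ω => Q.f ω.2.1) (fun ω => ω.1)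

/-- The constraints: alphabet size at most `cap`, `E w ≤ W`, `V → X → (X₁,X₂)`,
`X₂ → (X₁,V) → X`, and, if `strict` holds, even `X₂ → V → X`. -/
def Feasible (strict : Prop) (cap : ℕ∞) (s : Q.Input V) : Prop :=
  (Fintype.card V : ℕ∞) ≤ cap ∧
  expect s.joint (fun ω => Q.cost ω.2.1) ≤ (Q.W : EReal) ∧
  IsMarkov s.joint (fun ω => ω.1) (fun ω => ω.2.1) (fun ω => (Q.f ω.2.1, ω.2.2)) ∧
  IsMarkov s.joint (fun ω => ω.2.2) (fun ω => (Q.f ω.2.1, ω.1)) (fun ω => ω.2.1) ∧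
  (strict → IsMarkov s.joint (fun ω => ω.2.2) (fun ω => ω.1) (fun ω => ω.2.1))

/-- The rate tuple `(R₁, R₂, R₁', R₂')` satisfies the inequalities of the capacity region for the
given `(V, X)`. -/
def InRegion (s : Q.Input V) (R₁ R₂ R₁' R₂' : ℝ) : Prop :=
  0 ≤ R₁' ∧ R₁' ≤ R₁ ∧ 0 ≤ R₂' ∧ R₂' ≤ R₂ ∧
  R₁ ≤ entropy s.joint (fun ω => Q.f ω.2.1) ∧
  R₂ ≤ mutualInfo s.joint (fun ω => ω.1) (fun ω => ω.2.2) ∧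
  R₁ + R₂' = R₁' + R₂ ∧
  R₁ + R₂' ≤ condEntropy s.joint (fun ω => Q.f ω.2.1) (fun ω => ω.1)
    + mutualInfo s.joint (fun ω => ω.1) (fun ω => ω.2.2)

end Input

variable {X X₁ X₂ : Type*} [Fintype X] [Fintype X₁] [Fintype X₂]

/-- The values over which the maximum is taken. -/
def sumRates (strict : Prop) (cap : ℕ∞) (Q : SBC X X₁ X₂) : Set ℝ :=
  {r | ∃ (V : Type) (_ : Fintype V) (s : Q.Input V), s.Feasible strict cap ∧ s.sumRate = r}

/-- The sum-rate–cost function `R_SBC^sum(W)`. -/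
noncomputable def optSumRate (strict : Prop) (cap : ℕ∞) (Q : SBC X X₁ X₂) : ℝ :=
  sSup (Q.sumRates strict cap)

/-- `s` achieves the maximum. -/
def Input.Optimal {Q : SBC X X₁ X₂} {V : Type} [Fintype V]
    (strict : Prop) (cap : ℕ∞) (s : Q.Input V) : Prop :=
  s.Feasible strict cap ∧ IsGreatest (Q.sumRates strict cap) s.sumRate

end SBC

/-! ### Duality -/

section Duality

variable {X X₁ X₂ Y : Type*} [Fintype X] [Fintype X₁] [Fintype X₂] [Fintype Y]
  {V : Type} [Fintype V]

open Classical in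
/-- `Q` is the dual of the Berger–Yeung problem `P` for `p* = t.joint`, with `X = (X₁,X̂₂)`:
`x₁ = f(x)`, the channel is (a version of) `p*(x₂|x₁,x̂₂)`, the cost is
`w(x) = c₁ D(p*(x₁,x₂|x) ‖ p̄(x₁,x₂)) + θ`, `W = E w(X)`, and the message graph is that of `P`. -/
def IsDualSBC (P : BYP X₁ X₂ Y) (t : P.Test V) (c₁ θ : ℝ) (Q : SBC (X₁ × Y) X₁ X₂) : Prop :=
  (∀ x, Q.f x = x.1) ∧
  (∀ x x₂, law t.joint (fun ω => ((ω.1, ω.2.2.2), ω.2.1)) (x, x₂)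
    = law t.joint (fun ω => (ω.1, ω.2.2.2)) x * Q.chan x x₂) ∧
  (∀ x, Q.cost x = (c₁ : EReal) *
    relEntropy (fun z : X₁ × X₂ => if z.1 = Q.f x then Q.chan x z.2 else 0) P.source
      + (θ : EReal)) ∧
  (Q.W : EReal) = expect (law t.joint (fun ω => (ω.1, ω.2.2.2))) Q.cost ∧
  Q.graph = P.graph

/-- `s` consists of `p*(v)` and (a version of) `p*(x₁,x̂₂|v)`, where `p* = t.joint`. -/
def InducedInput {P : BYP X₁ X₂ Y} (t : P.Test V) {Q : SBC (X₁ × Y) X₁ X₂}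
    (s : Q.Input V) : Prop :=
  (∀ v, s.pV v = law t.joint (fun ω => ω.2.2.1) v) ∧
  ∀ v x, law t.joint (fun ω => (ω.2.2.1, (ω.1, ω.2.2.2))) (v, x)
    = law t.joint (fun ω => ω.2.2.1) v * s.pX v x

/-- `P` is the dual of the broadcast problem `Q` for `p* = s.joint`, where an input `x` is
identified with the pair `(x₁,x̂₂) = (f x, g x)`: the source is `p*(x₁,x₂)`, the distortion is
`d(x₁,x₂,x̂₂) = -c₂ log p̄(x₂|x) + d₀(x₁,x₂)` (`+∞` if `(x₁,x̂₂)` is not an input),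
`D = E d(X₁,X₂,X̂₂)`, and the message graph is that of `Q`. -/
def IsDualBYP (Q : SBC X X₁ X₂) (g : X → Y) (s : Q.Input V) (c₂ : ℝ) (d₀ : X₁ → X₂ → ℝ)
    (P : BYP X₁ X₂ Y) : Prop :=
  P.source = law s.joint (fun ω => (Q.f ω.2.1, ω.2.2)) ∧
  (∀ x x₂, P.dist (Q.f x) x₂ (g x)
    = (c₂ : EReal) * negLog (Q.chan x x₂) + (d₀ (Q.f x) x₂ : EReal)) ∧
  (∀ x₁ x₂ y, (∀ x, (Q.f x, g x) ≠ (x₁, y)) → P.dist x₁ x₂ y = ⊤) ∧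
  (P.D : EReal) = expect s.joint (fun ω => P.dist (Q.f ω.2.1) ω.2.2 (g ω.2.1)) ∧
  P.graph = Q.graph

/-- `t` consists of (versions of) `p*(v|x₂)` and `p*(x̂₂|x₁,v)`, where `p* = s.joint`. -/
def InducedTest {Q : SBC X X₁ X₂} (g : X → Y) (s : Q.Input V) {P : BYP X₁ X₂ Y}
    (t : P.Test V) : Prop :=
  (∀ x₂ v, law s.joint (fun ω => (ω.2.2, ω.1)) (x₂, v)
    = law s.joint (fun ω => ω.2.2) x₂ * t.pV x₂ v) ∧
  ∀ x₁ v y, law s.joint (fun ω => ((Q.f ω.2.1, ω.1), g ω.2.1)) ((x₁, v), y)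
    = law s.joint (fun ω => (Q.f ω.2.1, ω.1)) (x₁, v) * t.pY (x₁, v) y

/-- Both problems have the same joint distribution of `(X₁, X₂, V, X̂₂)`. -/
def SameJoint {P : BYP X₁ X₂ Y} {Q : SBC X X₁ X₂} (g : X → Y)
    (t : P.Test V) (s : Q.Input V) : Prop :=
  t.joint = law s.joint (fun ω => (Q.f ω.2.1, ω.2.2, ω.1, g ω.2.1))

/-- Both problems have the same correlation structure of the messages: the same message graph; the
same codebooks with the same bins generate the same graphs in both; and the rate parameters
`(R₁, R₂, R₁', R₂')` of the graphs that have the optimal sum-rate are the same in both. -/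
def SameCorrelation (strict : Prop) (capB capS : ℕ∞) {P : BYP X₁ X₂ Y} {Q : SBC X X₁ X₂}
    (t : P.Test V) (s : Q.Input V) : Prop :=
  P.graph = Q.graph ∧
  (∀ (G : MessageGraph) (ε : ℝ) (n M₁ M₂ : ℕ)
    (c₁ : Fin M₁ → Fin n → X₁) (c₂ : Fin M₂ → Fin n → V)
    (b₁ : Fin M₁ → Fin G.Δ₁) (b₂ : Fin M₂ → Fin G.Δ₂),
    G.GeneratedBy (law t.joint (fun ω => (ω.1, ω.2.2.1))) ε c₁ c₂ b₁ b₂ ↔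
      G.GeneratedBy (law s.joint (fun ω => (Q.f ω.2.1, ω.1))) ε c₁ c₂ b₁ b₂) ∧
  ∀ R₁ R₂ R₁' R₂' : ℝ,
    (t.InRegion R₁ R₂ R₁' R₂' ∧ R₁ + R₂' = P.optSumRate strict capB) ↔
      (s.InRegion R₁ R₂ R₁' R₂' ∧ R₁ + R₂' = Q.optSumRate strict capS)

end Duality

/-! Both sum-rates are compared with the single quantity $J=I(X;X_1,X_2)=H(X_1,X_2)-H(X_2|X)$, where
$X=(X_1,\hat X_2)$. The Markov conditions of the source problem give sum-rate $=J+I(V;X_2|X)\ge J$;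
those of the channel problem give sum-rate $=J-I(X_1;V|X_2)\le J$. The Markov condition assumed in
each direction makes the law $p^*$ satisfy the constraints of both problems, so there both gaps
vanish and both sum-rates equal $J$ (`le_sumRate_of_isMarkov`, `sumRate_le_of_isMarkov`,
`sumRate_eq_of_isMarkov`).

It remains to see that the dual constraint makes $p^*$ extremal for $J$, and the cost and distortion
are built so that this is Gibbs' inequality. The relative entropy cost has mean $c_1(E[-\log\bar
p(X_1,X_2)]-H(X_2|X))+\theta$. Since $H(X_1,X_2)\le E[-\log\bar p(X_1,X_2)]$, the cost constraint
bounds $J$ above, with equality at $p^*$, whose $(X_1,X_2)$-law is $\bar p$. The logarithmic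
distortion has mean $c_2E[-\log\bar p(X_2|X)]$ plus a constant fixed by the source. Since
$H(X_2|X)\le E[-\log\bar p(X_2|X)]$ and $H(X_1,X_2)$ is fixed, the distortion constraint bounds $J$
below, again with equality at $p^*$.

Infinite costs only restrict supports: a finite expectation provides the absolute continuity that
Gibbs' inequality needs. The correlation statements then follow from the common joint law and linear
relations between entropies. -/

section FiniteProbability

/-! ### Laws of random variables and disintegration -/

variable {Ω α β γ δ : Type*} [Fintype Ω]

theorem law_nonneg {P : Ω → ℝ} (hP : ∀ ω, 0 ≤ P ω) (X : Ω → α) (a : α) : 0 ≤ law P X a := by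
  classical
  unfold law
  exact Finset.sum_nonneg fun ω _ => by split_ifs <;> simp [hP]

theorem sum_law_mul [Fintype α] (P : Ω → ℝ) (X : Ω → α) (h : α → ℝ) :
    ∑ a, law P X a * h a = ∑ ω, P ω * h (X ω) := by
  classical
  simp only [law, Finset.sum_mul, ite_mul, zero_mul]
  rw [Finset.sum_comm]
  simp

theorem sum_law [Fintype α] (P : Ω → ℝ) (X : Ω → α) : ∑ a, law P X a = ∑ ω, P ω := by
  simpa using sum_law_mul P X fun _ => 1

theorem law_congr {P : Ω → ℝ} {X : Ω → α} {Z : Ω → β} {a : α} {b : β}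
    (h : ∀ ω, X ω = a ↔ Z ω = b) : law P X a = law P Z b := by
  classical
  exact Finset.sum_congr rfl fun ω _ => by
    by_cases hb : Z ω = b
    · rw [if_pos hb, if_pos ((h ω).2 hb)]
    · rw [if_neg hb, if_neg (mt (h ω).1 hb)]

theorem law_law [Fintype β] (P : Ω → ℝ) (Z : Ω → β) (X : β → α) :
    law (law P Z) X = law P (fun ω => X (Z ω)) := by
  classical
  funext a
  have := sum_law_mul P Z fun b => if X b = a then 1 else 0
  simpa [law] using this

theorem law_apply_of_injective (P : Ω → ℝ) {Z : Ω → α} (hZ : Function.Injective Z) (ω : Ω) :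
    law P Z (Z ω) = P ω := by
  classical
  rw [law_congr (X := Z) (Z := id) (b := ω) fun ω' => hZ.eq_iff]
  simp [law]

theorem le_law {P : Ω → ℝ} (hP : ∀ ω, 0 ≤ P ω) (X : Ω → α) (ω : Ω) : P ω ≤ law P X (X ω) := by
  classical
  have := Finset.single_le_sum (f := fun ω' => if X ω' = X ω then P ω' else 0) (s := Finset.univ)
    (fun ω' _ => by split_ifs <;> simp [hP]) (Finset.mem_univ ω)
  simpa [law] using this

theorem law_pos {P : Ω → ℝ} (hP : ∀ ω, 0 ≤ P ω) (X : Ω → α) {ω : Ω} (hω : P ω ≠ 0) :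
    0 < law P X (X ω) :=
  ((hP ω).lt_of_ne' hω).trans_le (le_law hP X ω)

theorem exists_of_law_ne_zero {P : Ω → ℝ} {X : Ω → α} {a : α} (h : law P X a ≠ 0) :
    ∃ ω, P ω ≠ 0 ∧ X ω = a := by
  classical
  obtain ⟨ω, -, hω⟩ := Finset.exists_ne_zero_of_sum_ne_zero h
  by_cases hX : X ω = a
  · exact ⟨ω, by simpa [hX] using hω, hX⟩
  · simp [hX] at hω

theorem law_eq_zero_of_imp {P : Ω → ℝ} (hP : ∀ ω, 0 ≤ P ω) {X : Ω → α} {Z : Ω → β} {a : α} {b : β}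
    (h : ∀ ω, X ω = a → Z ω = b) (h0 : law P Z b = 0) : law P X a = 0 := by
  by_contra hne
  obtain ⟨ω, hω, hX⟩ := exists_of_law_ne_zero hne
  exact (law_pos hP Z hω).ne' (h ω hX ▸ h0)

/-- The map `h` may depend on the value of `B`; this lets `IsMarkov.map_right` use the middle
variable of a chain. -/
theorem law_prod_map [Fintype γ] (P : Ω → ℝ) (B : Ω → β) (C : Ω → γ) (h : β → γ → δ)
    (b : β) (d : δ) :
    law P (fun ω => (B ω, h (B ω) (C ω))) (b, d)
      = open Classical in ∑ c, if h b c = d then law P (fun ω => (B ω, C ω)) (b, c) else 0 := by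
  classical
  have key : law P (fun ω => (B ω, h (B ω) (C ω))) (b, d)
      = ∑ ω, ∑ c, if C ω = c then (if h b c = d then (if B ω = b then P ω else 0) else 0)
          else 0 := by
    unfold law
    refine Finset.sum_congr rfl fun ω _ => ?_
    rw [Finset.sum_ite_eq]
    by_cases hb : B ω = b <;> simp [hb]
  rw [key, Finset.sum_comm]
  refine Finset.sum_congr rfl fun c _ => ?_
  by_cases hc : h b c = d
  · simp only [hc, if_true, law, Prod.mk.injEq]
    refine Finset.sum_congr rfl fun ω _ => ?_
    by_cases h1 : B ω = b <;> by_cases h2 : C ω = c <;> simp [h1, h2]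
  · simp [hc]

theorem sum_law_prod [Fintype γ] (P : Ω → ℝ) (B : Ω → β) (C : Ω → γ) (b : β) :
    ∑ c, law P (fun ω => (B ω, C ω)) (b, c) = law P B b := by
  classical
  have := law_prod_map P B C (fun _ _ => ()) b ()
  simp only [if_true] at this
  rw [← this]
  exact law_congr fun ω => by simp

/-- Every joint law disintegrates. -/
theorem exists_condDist [Fintype γ] [Nonempty γ] {P : Ω → ℝ} (hP : ∀ ω, 0 ≤ P ω)
    (B : Ω → β) (C : Ω → γ) :
    ∃ K : β → γ → ℝ, IsCondDist K ∧
      ∀ b c, law P (fun ω => (B ω, C ω)) (b, c) = law P B b * K b c := by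
  classical
  -- On null values of `B` a point mass serves as the conditional law, so that every row is a
  -- distribution.
  refine ⟨fun b c => if law P B b = 0 then (if c = Classical.arbitrary γ then 1 else 0)
    else law P (fun ω => (B ω, C ω)) (b, c) / law P B b, fun b => ⟨fun c => ?_, ?_⟩, fun b c => ?_⟩
  · dsimp only
    split_ifs
    · exact zero_le_one
    · exact le_rfl
    · exact div_nonneg (law_nonneg hP _ _) (law_nonneg hP _ _)
  · by_cases hb : law P B b = 0
    · simp [hb]
    · simp only [hb, if_false]
      rw [← Finset.sum_div, sum_law_prod, div_self hb]
  · by_cases hb : law P B b = 0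
    · rw [hb, zero_mul]
      exact law_eq_zero_of_imp hP (fun ω h => (Prod.mk.inj h).1) hb
    · simp only [hb, if_false]
      field_simp

/-! ### Entropy -/

theorem entropy_eq_sum [Fintype α] (P : Ω → ℝ) (X : Ω → α) :
    entropy P X = ∑ ω, P ω * -Real.log (law P X (X ω)) := by
  rw [← sum_law_mul P X fun a => -Real.log (law P X a)]
  simp [entropy, Real.negMulLog]

/-- Entropy sees only the partition induced by the variable. This is how tuples are reordered and
redundant coordinates such as `f (X ω)` next to `X ω` are dropped. -/
theorem entropy_congr [Fintype α] [Fintype β] {P : Ω → ℝ} {X : Ω → α} {Z : Ω → β}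
    (h : ∀ ω ω', X ω = X ω' ↔ Z ω = Z ω') : entropy P X = entropy P Z := by
  simp only [entropy_eq_sum]
  exact Finset.sum_congr rfl fun ω _ => by rw [law_congr fun ω' => h ω' ω]

theorem entropy_law [Fintype α] [Fintype β] (P : Ω → ℝ) (Z : Ω → β) (X : β → α) :
    entropy (law P Z) X = entropy P (fun ω => X (Z ω)) := by
  simp only [entropy, law_law]

/-- Gibbs' inequality. -/
theorem entropy_le_crossEntropy [Fintype α] {P : Ω → ℝ} (hP : ∀ ω, 0 ≤ P ω) (X : Ω → α)
    {q : α → ℝ} (hq : ∀ a, 0 ≤ q a) (hq1 : ∑ a, q a ≤ ∑ ω, P ω)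
    (hac : ∀ ω, P ω ≠ 0 → q (X ω) ≠ 0) :
    entropy P X ≤ ∑ ω, P ω * -Real.log (q (X ω)) := by
  -- This is $\log t\le t-1$ at $t=q/p$.
  have hpt : ∀ ω, P ω * -Real.log (law P X (X ω))
      ≤ P ω * -Real.log (q (X ω)) + (P ω * (q (X ω) / law P X (X ω)) - P ω) := by
    intro ω
    by_cases hω : P ω = 0
    · simp [hω]
    have hl := law_pos hP X hω
    have hqpos := (hq (X ω)).lt_of_ne' (hac ω hω)
    have := Real.log_le_sub_one_of_pos (div_pos hqpos hl)
    rw [Real.log_div hqpos.ne' hl.ne'] at this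
    nlinarith [mul_le_mul_of_nonneg_left this (hP ω)]
  -- Only an inequality: `q` may charge points that `X` does not reach, where the quotient is `0` by
  -- convention.
  have hsum : ∑ ω, P ω * (q (X ω) / law P X (X ω)) ≤ ∑ a, q a := by
    rw [← sum_law_mul P X fun a => q a / law P X a]
    refine Finset.sum_le_sum fun a _ => ?_
    by_cases ha : law P X a = 0
    · simp [ha, hq]
    · rw [mul_div_cancel₀ _ ha]
  have := Finset.sum_le_sum fun ω (_ : ω ∈ Finset.univ) => hpt ω
  rw [Finset.sum_add_distrib, Finset.sum_sub_distrib] at this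
  rw [entropy_eq_sum]
  linarith

/-- The chain rule, for an arbitrary version `K` of the conditional law: null values of `A` carry no
weight. -/
theorem entropy_prod_sub_eq [Fintype α] [Fintype β] {P : Ω → ℝ} (hP : ∀ ω, 0 ≤ P ω)
    {A : Ω → α} {B : Ω → β} {K : α → β → ℝ}
    (hK : ∀ a b, law P (fun ω => (A ω, B ω)) (a, b) = law P A a * K a b) :
    entropy P (fun ω => (A ω, B ω)) - entropy P A = ∑ ω, P ω * -Real.log (K (A ω) (B ω)) := by
  simp only [entropy_eq_sum, ← Finset.sum_sub_distrib]
  refine Finset.sum_congr rfl fun ω _ => ?_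
  by_cases hω : P ω = 0
  · simp [hω]
  have hA := (law_pos hP A hω).ne'
  have hAB := (law_pos hP (fun ω => (A ω, B ω)) hω).ne'
  rw [hK] at hAB ⊢
  rw [Real.log_mul hA (right_ne_zero_of_mul hAB)]
  ring

/-- Gibbs' inequality against the weights `law P A a * K a b`. Rows of mass at most one suffice,
which admits a channel extended by `0`. -/
theorem entropy_prod_sub_le [Fintype α] [Fintype β] {P : Ω → ℝ} (hP : ∀ ω, 0 ≤ P ω)
    (A : Ω → α) (B : Ω → β) {K : α → β → ℝ} (hK : ∀ a b, 0 ≤ K a b) (hK1 : ∀ a, ∑ b, K a b ≤ 1)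
    (hac : ∀ ω, P ω ≠ 0 → K (A ω) (B ω) ≠ 0) :
    entropy P (fun ω => (A ω, B ω)) - entropy P A ≤ ∑ ω, P ω * -Real.log (K (A ω) (B ω)) := by
  have := entropy_le_crossEntropy hP (fun ω => (A ω, B ω)) (q := fun z => law P A z.1 * K z.1 z.2)
    (fun z => mul_nonneg (law_nonneg hP _ _) (hK _ _))
    (by
      rw [Fintype.sum_prod_type, ← sum_law P A]
      refine Finset.sum_le_sum fun a _ => ?_
      simp only [← Finset.mul_sum]
      exact mul_le_of_le_one_right (law_nonneg hP _ _) (hK1 a))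
    (fun ω hω => mul_ne_zero (law_pos hP A hω).ne' (hac ω hω))
  rw [sub_le_iff_le_add, entropy_eq_sum P A, ← Finset.sum_add_distrib]
  refine this.trans_eq (Finset.sum_congr rfl fun ω _ => ?_)
  by_cases hω : P ω = 0
  · simp [hω]
  rw [Real.log_mul (law_pos hP A hω).ne' (hac ω hω)]
  ring

/-- Conditioning reduces entropy: the conditional law of `C` given `B` is used as a guess for the
one given `(A, B)`. Its rows at null values of `B` are zero, hence the need for substochastic
kernels. -/
theorem entropy_submodular [Fintype α] [Fintype β] [Fintype γ] {P : Ω → ℝ} (hP : ∀ ω, 0 ≤ P ω)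
    (A : Ω → α) (B : Ω → β) (C : Ω → γ) :
    entropy P (fun ω => (A ω, B ω, C ω)) + entropy P B
      ≤ entropy P (fun ω => (A ω, B ω)) + entropy P (fun ω => (B ω, C ω)) := by
  have hK : ∀ b c, law P (fun ω => (B ω, C ω)) (b, c)
      = law P B b * (law P (fun ω => (B ω, C ω)) (b, c) / law P B b) := by
    intro b c
    by_cases hb : law P B b = 0
    · rw [hb, zero_mul]
      exact law_eq_zero_of_imp hP (fun ω h => (Prod.mk.inj h).1) hb
    · field_simp
  have h1 := entropy_prod_sub_eq hP hK
  have h2 := entropy_prod_sub_le hP (fun ω => (A ω, B ω)) C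
    (K := fun z c => law P (fun ω => (B ω, C ω)) (z.2, c) / law P B z.2)
    (fun z c => div_nonneg (law_nonneg hP _ _) (law_nonneg hP _ _))
    (fun z => by rw [← Finset.sum_div, sum_law_prod]; exact div_self_le_one _)
    (fun ω hω => div_ne_zero (law_pos hP (fun ω => (B ω, C ω)) hω).ne' (law_pos hP B hω).ne')
  have h3 : entropy P (fun ω => (A ω, B ω, C ω)) = entropy P (fun ω => ((A ω, B ω), C ω)) :=
    entropy_congr fun ω ω' => by simp [and_assoc]
  simp only at h2
  linarith

/-! ### Markov chains -/

/-- The logarithm of the factorization, averaged over the support of `P`. -/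
theorem IsMarkov.entropy_eq [Fintype α] [Fintype β] [Fintype γ] {P : Ω → ℝ} (hP : ∀ ω, 0 ≤ P ω)
    {A : Ω → α} {B : Ω → β} {C : Ω → γ} (h : IsMarkov P A B C) :
    entropy P (fun ω => (A ω, B ω, C ω)) + entropy P B
      = entropy P (fun ω => (A ω, B ω)) + entropy P (fun ω => (B ω, C ω)) := by
  simp only [entropy_eq_sum, ← Finset.sum_add_distrib]
  refine Finset.sum_congr rfl fun ω _ => ?_
  by_cases hω : P ω = 0
  · simp [hω]
  have h1 := congrArg Real.log (h (A ω) (B ω) (C ω))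
  rw [Real.log_mul (law_pos hP (fun ω => (A ω, B ω, C ω)) hω).ne' (law_pos hP B hω).ne',
    Real.log_mul (law_pos hP (fun ω => (A ω, B ω)) hω).ne'
      (law_pos hP (fun ω => (B ω, C ω)) hω).ne'] at h1
  linear_combination -P ω * h1

theorem IsMarkov.law_eq {P : Ω → ℝ} (hP : ∀ ω, 0 ≤ P ω) {A : Ω → α} {B : Ω → β} {C : Ω → γ}
    (h : IsMarkov P A B C) {K : β → γ → ℝ}
    (hK : ∀ b c, law P (fun ω => (B ω, C ω)) (b, c) = law P B b * K b c) (a : α) (b : β) (c : γ) :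
    law P (fun ω => (A ω, B ω, C ω)) (a, b, c) = law P (fun ω => (A ω, B ω)) (a, b) * K b c := by
  by_cases hb : law P B b = 0
  · rw [law_eq_zero_of_imp hP (fun ω h => by simp_all) hb,
      law_eq_zero_of_imp hP (X := fun ω => (A ω, B ω)) (fun ω h => by simp_all) hb, zero_mul]
  · have := h a b c
    rw [hK] at this
    exact mul_right_cancel₀ hb (by rw [this]; ring)

theorem IsMarkov.map_right [Fintype γ] {P : Ω → ℝ} {A : Ω → α} {B : Ω → β} {C : Ω → γ}
    (h : IsMarkov P A B C) (F : β → γ → δ) : IsMarkov P A B (fun ω => F (B ω) (C ω)) := by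
  classical
  intro a b d
  have h1 : law P (fun ω => (A ω, B ω, F (B ω) (C ω))) (a, b, d)
      = ∑ c, if F b c = d then law P (fun ω => (A ω, B ω, C ω)) (a, b, c) else 0 := by
    rw [law_congr (Z := fun ω => ((A ω, B ω), F (B ω) (C ω))) (b := ((a, b), d))
      (fun ω => by simp [and_assoc]), law_prod_map P (fun ω => (A ω, B ω)) C fun z c => F z.2 c]
    refine Finset.sum_congr rfl fun c _ => ?_
    rw [law_congr (P := P) (Z := fun ω => (A ω, B ω, C ω)) (b := (a, b, c))
      (fun ω => by simp [and_assoc])]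
  rw [h1, law_prod_map P B C F b d, Finset.sum_mul, Finset.mul_sum]
  refine Finset.sum_congr rfl fun c _ => ?_
  split_ifs
  · exact h a b c
  · simp

theorem isMarkov_law_iff [Fintype δ] {ε : Type*} (P : Ω → ℝ) (Z : Ω → δ) (A : δ → α) (B : δ → β)
    (C : δ → ε) :
    IsMarkov (law P Z) A B C ↔
      IsMarkov P (fun ω => A (Z ω)) (fun ω => B (Z ω)) (fun ω => C (Z ω)) := by
  simp only [IsMarkov, law_law]

/-! ### Extended-real expectations -/

theorem EReal.sum_ne_bot_of_forall {ι : Type*} {s : Finset ι} {h : ι → EReal}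
    (hb : ∀ i ∈ s, h i ≠ ⊥) : ∑ i ∈ s, h i ≠ ⊥ := by
  classical
  induction s using Finset.induction_on with
  | empty => simp
  | insert i s hi ih =>
    rw [Finset.sum_insert hi]
    have h1 := hb i (by simp)
    have h2 := ih fun j hj => hb j (by simp [hj])
    simp [EReal.add_eq_bot_iff, h1, h2]

/-- Excluding `⊥` is essential, since `⊤ + ⊥ = ⊥`. -/
theorem EReal.sum_eq_top_of_eq_top {ι : Type*} [Fintype ι] {h : ι → EReal} (hb : ∀ i, h i ≠ ⊥)
    {i : ι} (hi : h i = ⊤) : ∑ i, h i = ⊤ := by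
  classical
  rw [← Finset.add_sum_erase _ _ (Finset.mem_univ i), hi]
  exact EReal.top_add_of_ne_bot (EReal.sum_ne_bot_of_forall fun j _ => hb j)

theorem EReal.coe_sum_eq {ι : Type*} (s : Finset ι) (k : ι → ℝ) :
    ((∑ i ∈ s, k i : ℝ) : EReal) = ∑ i ∈ s, (k i : EReal) := by
  classical
  induction s using Finset.induction_on with
  | empty => simp
  | insert i s hi ih => rw [Finset.sum_insert hi, Finset.sum_insert hi, EReal.coe_add, ih]

theorem EReal.coe_sum_mul {ι : Type*} (s : Finset ι) {k : ι → ℝ} (hk : ∀ i, 0 ≤ k i) (c : EReal) :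
    ((∑ i ∈ s, k i : ℝ) : EReal) * c = ∑ i ∈ s, (k i : EReal) * c := by
  classical
  induction s using Finset.induction_on with
  | empty => simp
  | insert i s hi ih =>
    rw [Finset.sum_insert hi, Finset.sum_insert hi, EReal.coe_add, ← ih]
    exact EReal.right_distrib_of_nonneg (EReal.coe_nonneg.2 (hk i))
      (EReal.coe_nonneg.2 (Finset.sum_nonneg fun j _ => hk j))

theorem expect_eq_coe {P : Ω → ℝ} {h : Ω → EReal} {k : Ω → ℝ}
    (hk : ∀ ω, P ω ≠ 0 → h ω = (k ω : EReal)) :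
    expect P h = ((∑ ω, P ω * k ω : ℝ) : EReal) := by
  rw [EReal.coe_sum_eq, expect]
  refine Finset.sum_congr rfl fun ω _ => ?_
  by_cases hω : P ω = 0
  · simp [hω]
  · rw [hk ω hω, EReal.coe_mul]

/-- Turns infinite values of a cost or distortion into a constraint on the support. -/
theorem ne_top_of_expect_le {P : Ω → ℝ} (hP : ∀ ω, 0 ≤ P ω) {h : Ω → EReal} (hb : ∀ ω, h ω ≠ ⊥)
    {w : ℝ} (hle : expect P h ≤ (w : EReal)) {ω : Ω} (hω : P ω ≠ 0) : h ω ≠ ⊤ := by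
  intro htop
  have hpos := (hP ω).lt_of_ne' hω
  have : expect P h = ⊤ := by
    refine EReal.sum_eq_top_of_eq_top (i := ω) (fun ω' => ?_) ?_
    · by_cases h0 : P ω' = 0
      · simp [h0]
      have hpos' := (hP ω').lt_of_ne' h0
      induction hh : h ω' with
      | bot => exact absurd hh (hb ω')
      | coe r => rw [← EReal.coe_mul]; exact EReal.coe_ne_bot _
      | top => simp [EReal.coe_mul_top_of_pos hpos']
    · rw [htop, EReal.coe_mul_top_of_pos hpos]
  rw [this, top_le_iff] at hle
  exact EReal.coe_ne_top w hle

theorem expect_law [Fintype α] {P : Ω → ℝ} (hP : ∀ ω, 0 ≤ P ω) (Z : Ω → α) (h : α → EReal) :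
    expect (law P Z) h = expect P (fun ω => h (Z ω)) := by
  classical
  have : ∀ a, (law P Z a : EReal) * h a
      = ∑ ω, if Z ω = a then (P ω : EReal) * h a else 0 := by
    intro a
    rw [law, EReal.coe_sum_mul _ fun ω => by split_ifs <;> simp [hP]]
    exact Finset.sum_congr rfl fun ω _ => by split_ifs <;> simp
  simp only [expect, this]
  rw [Finset.sum_comm]
  simp

theorem relEntropy_eq_top [Fintype α] {p q : α → ℝ} {a : α} (hp : p a ≠ 0) (hq : q a = 0) :
    relEntropy p q = ⊤ := by
  classical
  refine EReal.sum_eq_top_of_eq_top (i := a) (fun a => ?_) (by simp [hp, hq])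
  split_ifs
  · simp
  · simp
  · exact EReal.coe_ne_bot _

theorem relEntropy_eq_coe [Fintype α] {p q : α → ℝ} (h : ∀ a, p a ≠ 0 → q a ≠ 0) :
    relEntropy p q = ((∑ a, p a * Real.log (p a / q a) : ℝ) : EReal) := by
  classical
  rw [relEntropy, EReal.coe_sum_eq]
  refine Finset.sum_congr rfl fun a _ => ?_
  by_cases hp : p a = 0
  · simp [hp]
  · simp [hp, h a hp]

theorem relEntropy_nonneg [Fintype α] {p q : α → ℝ} (hp : p ∈ stdSimplex ℝ α)
    (hq : q ∈ stdSimplex ℝ α) : 0 ≤ relEntropy p q := by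
  by_cases h : ∀ a, p a ≠ 0 → q a ≠ 0
  · rw [relEntropy_eq_coe h, EReal.coe_nonneg]
    have hlaw : ∀ a, law p id a = p a := law_apply_of_injective p Function.injective_id
    have := entropy_le_crossEntropy hp.1 id hq.1 (by rw [hp.2, hq.2]) h
    rw [entropy_eq_sum, ← sub_nonneg, ← Finset.sum_sub_distrib] at this
    refine this.trans_eq (Finset.sum_congr rfl fun a _ => ?_)
    by_cases h0 : p a = 0
    · simp [h0]
    · simp only [id, hlaw]
      rw [Real.log_div h0 (h a h0)]
      ring
  · push Not at h
    obtain ⟨a, ha, ha'⟩ := h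
    simp [relEntropy_eq_top ha ha']

theorem relEntropy_ne_bot [Fintype α] (p q : α → ℝ) : relEntropy p q ≠ ⊥ := by
  classical
  refine EReal.sum_ne_bot_of_forall fun a _ => ?_
  split_ifs
  · simp
  · simp
  · exact EReal.coe_ne_bot _

theorem negLog_of_ne_zero {t : ℝ} (ht : t ≠ 0) : negLog t = ((-Real.log t : ℝ) : EReal) := by
  simp [negLog, ht]

theorem negLog_zero : negLog 0 = ⊤ := by simp [negLog]

theorem negLog_nonneg {t : ℝ} (h0 : 0 ≤ t) (h1 : t ≤ 1) : 0 ≤ negLog t := by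
  by_cases ht : t = 0
  · simp [ht, negLog_zero]
  · rw [negLog_of_ne_zero ht, EReal.coe_nonneg]
    linarith [Real.log_nonpos h0 h1]

theorem EReal.coe_mul_add_ne_bot {c : ℝ} (hc : 0 < c) {r : EReal} (hr : r ≠ ⊥) (θ : ℝ) :
    (c : EReal) * r + (θ : EReal) ≠ ⊥ := by
  induction r with
  | bot => exact absurd rfl hr
  | coe r => rw [← EReal.coe_mul, ← EReal.coe_add]; exact EReal.coe_ne_bot _
  | top => simp [EReal.coe_mul_top_of_pos hc]

theorem EReal.coe_mul_top_add {c : ℝ} (hc : 0 < c) (θ : ℝ) :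
    (c : EReal) * ⊤ + (θ : EReal) = ⊤ := by
  simp [EReal.coe_mul_top_of_pos hc]

end FiniteProbability

/-! ### Comparison of the sum-rate with $I(X;X_1,X_2)$ -/

section SumRateBounds

variable {Ω α β γ δ : Type*} [Fintype Ω] [Fintype α] [Fintype β] [Fintype γ] [Fintype δ]

/-- `I(A,Y;A,B) ≤ H(A) + I(V;B) - I(A;V)` if `A → B → V` and `B → (A,V) → Y`. -/
theorem le_sumRate_of_isMarkov {P : Ω → ℝ} (hP : ∀ ω, 0 ≤ P ω) {A : Ω → α} {B : Ω → β}
    {V : Ω → γ} {Y : Ω → δ} (h1 : IsMarkov P A B V) (h2 : IsMarkov P B (fun ω => (A ω, V ω)) Y) :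
    entropy P (fun ω => (A ω, B ω)) + entropy P (fun ω => (A ω, Y ω))
        - entropy P (fun ω => ((A ω, Y ω), B ω))
      ≤ entropy P A + mutualInfo P V B - mutualInfo P A V := by
  -- The first chain gives sum-rate $=H(A,B)-H(B|A,V)$, the second $H(B|A,V)=H(B|A,V,Y)$, and
  -- dropping $V$ from the condition can only increase this to $H(B|A,Y)$.
  have e1 := h1.entropy_eq hP
  have e2 := h2.entropy_eq hP
  have e3 := entropy_submodular hP V (fun ω => (A ω, Y ω)) B
  have c1 : entropy P (fun ω => (V ω, B ω)) = entropy P (fun ω => (B ω, V ω)) :=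
    entropy_congr fun ω ω' => by simp only [Prod.mk.injEq]; tauto
  have c2 : entropy P (fun ω => (B ω, (A ω, V ω), Y ω))
      = entropy P (fun ω => (V ω, (A ω, Y ω), B ω)) :=
    entropy_congr fun ω ω' => by simp only [Prod.mk.injEq]; tauto
  have c3 : entropy P (fun ω => (B ω, (A ω, V ω))) = entropy P (fun ω => (A ω, B ω, V ω)) :=
    entropy_congr fun ω ω' => by simp only [Prod.mk.injEq]; tauto
  have c4 : entropy P (fun ω => ((A ω, V ω), Y ω)) = entropy P (fun ω => (V ω, (A ω, Y ω))) :=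
    entropy_congr fun ω ω' => by simp only [Prod.mk.injEq]; tauto
  unfold mutualInfo
  linarith

/-- Both sides are minus a conditional entropy of $B$: $H(B|X)=H(B|X,V)=H(B|f(X),V)$, one equality
from each chain. -/
theorem entropy_eq_of_isMarkov_input {ξ : Type*} [Fintype ξ] {P : Ω → ℝ} (hP : ∀ ω, 0 ≤ P ω)
    {X : Ω → ξ} {f : ξ → α} {B : Ω → β} {V : Ω → γ}
    (h1 : IsMarkov P V X (fun ω => (f (X ω), B ω)))
    (h2 : IsMarkov P B (fun ω => (f (X ω), V ω)) X) :
    entropy P X - entropy P (fun ω => (X ω, B ω))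
      = entropy P (fun ω => (f (X ω), V ω)) - entropy P (fun ω => (f (X ω), B ω, V ω)) := by
  have e1 := h1.entropy_eq hP
  have e2 := h2.entropy_eq hP
  have c1 : entropy P (fun ω => (V ω, X ω, (f (X ω), B ω)))
      = entropy P (fun ω => (B ω, (f (X ω), V ω), X ω)) :=
    entropy_congr fun ω ω' => by
      simp only [Prod.mk.injEq]
      constructor
      · rintro ⟨h, h', -, h''⟩; exact ⟨h'', ⟨congrArg f h', h⟩, h'⟩
      · rintro ⟨h, ⟨h', h''⟩, h3⟩; exact ⟨h'', h3, h', h⟩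
  have c2 : entropy P (fun ω => (X ω, (f (X ω), B ω))) = entropy P (fun ω => (X ω, B ω)) :=
    entropy_congr fun ω ω' => by
      simp only [Prod.mk.injEq]
      exact ⟨fun h => ⟨h.1, h.2.2⟩, fun h => ⟨h.1, congrArg f h.1, h.2⟩⟩
  have c3 : entropy P (fun ω => ((f (X ω), V ω), X ω)) = entropy P (fun ω => (V ω, X ω)) :=
    entropy_congr fun ω ω' => by
      simp only [Prod.mk.injEq]
      exact ⟨fun h => ⟨h.1.2, h.2⟩, fun h => ⟨⟨congrArg f h.2, h.1⟩, h.2⟩⟩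
  have c4 : entropy P (fun ω => (B ω, (f (X ω), V ω)))
      = entropy P (fun ω => (f (X ω), B ω, V ω)) :=
    entropy_congr fun ω ω' => by simp only [Prod.mk.injEq]; tauto
  linarith

/-- `H(f(X)) + I(V;B) - I(f(X);V) ≤ I(X;f(X),B)` if `V → X → (f(X),B)` and `B → (f(X),V) → X`. -/
theorem sumRate_le_of_isMarkov {ξ : Type*} [Fintype ξ] {P : Ω → ℝ} (hP : ∀ ω, 0 ≤ P ω)
    {X : Ω → ξ} {f : ξ → α} {B : Ω → β} {V : Ω → γ}
    (h1 : IsMarkov P V X (fun ω => (f (X ω), B ω)))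
    (h2 : IsMarkov P B (fun ω => (f (X ω), V ω)) X) :
    entropy P (fun ω => f (X ω)) + mutualInfo P V B - mutualInfo P (fun ω => f (X ω)) V
      ≤ entropy P (fun ω => (f (X ω), B ω)) + entropy P X - entropy P (fun ω => (X ω, B ω)) := by
  have e1 := entropy_eq_of_isMarkov_input hP h1 h2
  -- The gap in the claim is exactly $I(f(X);V|B)\ge0$.
  have e2 := entropy_submodular hP (fun ω => f (X ω)) B V
  have c1 : entropy P (fun ω => (V ω, B ω)) = entropy P (fun ω => (B ω, V ω)) :=
    entropy_congr fun ω ω' => by simp only [Prod.mk.injEq]; tauto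
  unfold mutualInfo
  linarith

theorem sumRate_eq_of_isMarkov {ξ : Type*} [Fintype ξ] {P : Ω → ℝ} (hP : ∀ ω, 0 ≤ P ω)
    {X : Ω → ξ} {f : ξ → α} {B : Ω → β} {V : Ω → γ}
    (h1 : IsMarkov P V X (fun ω => (f (X ω), B ω)))
    (h2 : IsMarkov P B (fun ω => (f (X ω), V ω)) X)
    (h3 : IsMarkov P (fun ω => f (X ω)) B V) :
    entropy P (fun ω => f (X ω)) + mutualInfo P V B - mutualInfo P (fun ω => f (X ω)) V
      = entropy P (fun ω => (f (X ω), B ω)) + entropy P X - entropy P (fun ω => (X ω, B ω)) := by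
  have e1 := entropy_eq_of_isMarkov_input hP h1 h2
  have e2 := h3.entropy_eq hP
  have c1 : entropy P (fun ω => (V ω, B ω)) = entropy P (fun ω => (B ω, V ω)) :=
    entropy_congr fun ω ω' => by simp only [Prod.mk.injEq]; tauto
  unfold mutualInfo
  linarith

end SumRateBounds

theorem exists_ne_zero_of_mem_stdSimplex {α : Type*} [Fintype α] {p : α → ℝ}
    (hp : p ∈ stdSimplex ℝ α) : ∃ a, p a ≠ 0 := by
  by_contra! h
  simpa [h] using hp.2

theorem law_mem_stdSimplex {Ω α : Type*} [Fintype Ω] [Fintype α] {P : Ω → ℝ}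
    (hP : P ∈ stdSimplex ℝ Ω) (X : Ω → α) : law P X ∈ stdSimplex ℝ α :=
  ⟨law_nonneg hP.1 X, by rw [sum_law, hP.2]⟩

/-! ### Joint laws generated by a channel input -/

section Channel

variable {X X₁ X₂ : Type*} [Fintype X] [Fintype X₂] {V : Type} [Fintype V]

namespace SBC.Input

variable {Q : SBC X X₁ X₂}

theorem joint_nonneg (s : Q.Input V) (ω : V × X × X₂) : 0 ≤ s.joint ω :=
  mul_nonneg (mul_nonneg (s.pV_mem.1 _) ((s.pX_cond _).1 _)) ((Q.chan_cond _).1 _)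

theorem joint_mem (s : Q.Input V) : s.joint ∈ stdSimplex ℝ (V × X × X₂) :=
  ⟨s.joint_nonneg, by
    simp only [joint, Fintype.sum_prod_type, ← Finset.mul_sum, (Q.chan_cond _).2, mul_one,
      (s.pX_cond _).2, s.pV_mem.2]⟩

theorem law_channel (s : Q.Input V) (x : X) (x₂ : X₂) :
    law s.joint (fun ω => (ω.2.1, ω.2.2)) (x, x₂) = law s.joint (fun ω => ω.2.1) x * Q.chan x x₂ := by
  classical
  have h1 : law s.joint (fun ω => ω.2.1) x = ∑ v, s.pV v * s.pX v x := by
    have : ∀ v x', ∑ x₂, (if x' = x then s.joint (v, x', x₂) else 0)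
        = if x' = x then s.pV v * s.pX v x' else 0 := by
      intro v x'
      split_ifs
      · simp only [joint, ← Finset.mul_sum, (Q.chan_cond _).2, mul_one]
      · simp
    simp only [law, Fintype.sum_prod_type, this]
    simp
  rw [h1, Finset.sum_mul]
  simp only [law, Fintype.sum_prod_type, Prod.mk.injEq, ite_and]
  simp [joint]

/-- Averaging over the channel output before or after taking the expectation is the same; this
converts the relative entropy cost into an expected log-ratio. -/
theorem sum_joint_mul_sum_channel (s : Q.Input V) (l : X → X₂ → ℝ) :
    ∑ ω, s.joint ω * ∑ x₂, Q.chan ω.2.1 x₂ * l ω.2.1 x₂ = ∑ ω, s.joint ω * l ω.2.1 ω.2.2 := by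
  rw [← sum_law_mul s.joint (fun ω => ω.2.1) fun x => ∑ x₂, Q.chan x x₂ * l x x₂,
    ← sum_law_mul s.joint (fun ω => (ω.2.1, ω.2.2)) fun z => l z.1 z.2, Fintype.sum_prod_type]
  refine Finset.sum_congr rfl fun x _ => ?_
  rw [Finset.mul_sum]
  exact Finset.sum_congr rfl fun x₂ _ => by rw [law_channel, mul_assoc]

end SBC.Input

end Channel

/-! ### The channel on pairs -/

section PairChannel

variable {X X₁ X₂ Y : Type*} [Fintype X₂]

/-- The channel as a function of the pairs `(x₁,x̂₂)`, extended by `0`. -/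
noncomputable def SBC.pairChan (Q : SBC X X₁ X₂) (g : X → Y) : X₁ × Y → X₂ → ℝ :=
  Function.extend (fun x => (Q.f x, g x)) Q.chan 0

theorem SBC.pairChan_apply {Q : SBC X X₁ X₂} {g : X → Y}
    (hg : Function.Injective (fun x => (Q.f x, g x))) (x : X) :
    Q.pairChan g (Q.f x, g x) = Q.chan x :=
  hg.extend_apply _ _ x

theorem SBC.pairChan_eq_zero {Q : SBC X X₁ X₂} {g : X → Y} {z : X₁ × Y}
    (hz : ∀ x, (Q.f x, g x) ≠ z) : Q.pairChan g z = 0 :=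
  Function.extend_apply' _ _ _ (by simpa using hz)

theorem SBC.pairChan_eq_chan_or_zero {Q : SBC X X₁ X₂} {g : X → Y}
    (hg : Function.Injective (fun x => (Q.f x, g x))) (z : X₁ × Y) :
    (∃ x, Q.pairChan g z = Q.chan x) ∨ Q.pairChan g z = 0 := by
  by_cases h : ∃ x, (Q.f x, g x) = z
  · obtain ⟨x, rfl⟩ := h
    exact Or.inl ⟨x, SBC.pairChan_apply hg x⟩
  · exact Or.inr (SBC.pairChan_eq_zero (by simpa using h))

theorem SBC.pairChan_nonneg {Q : SBC X X₁ X₂} {g : X → Y}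
    (hg : Function.Injective (fun x => (Q.f x, g x))) (z : X₁ × Y) (x₂ : X₂) :
    0 ≤ Q.pairChan g z x₂ := by
  obtain ⟨x, hx⟩ | hx := SBC.pairChan_eq_chan_or_zero hg z
  · exact hx ▸ (Q.chan_cond x).1 x₂
  · simp [hx]

theorem SBC.sum_pairChan_le_one {Q : SBC X X₁ X₂} {g : X → Y}
    (hg : Function.Injective (fun x => (Q.f x, g x))) (z : X₁ × Y) :
    ∑ x₂, Q.pairChan g z x₂ ≤ 1 := by
  obtain ⟨x, hx⟩ | hx := SBC.pairChan_eq_chan_or_zero hg z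
  · exact hx ▸ (Q.chan_cond x).2.le
  · simp [hx]

theorem SBC.pairChan_le_one {Q : SBC X X₁ X₂} {g : X → Y}
    (hg : Function.Injective (fun x => (Q.f x, g x))) (z : X₁ × Y) (x₂ : X₂) :
    Q.pairChan g z x₂ ≤ 1 :=
  (Finset.single_le_sum (fun b _ => SBC.pairChan_nonneg hg z b) (Finset.mem_univ x₂)).trans
    (SBC.sum_pairChan_le_one hg z)

end PairChannel

/-! ### The dual distortion -/

section DualDistortion

variable {X X₁ X₂ Y : Type*} [Fintype X] [Fintype X₁] [Fintype X₂] {V : Type} [Fintype V]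

/-- Extending the channel by `0` absorbs the pairs that are not inputs into the same formula, as
$-\log 0=+\infty$ and $c_2>0$. -/
theorem IsDualBYP.dist_eq {Q : SBC X X₁ X₂} {g : X → Y}
    (hg : Function.Injective (fun x => (Q.f x, g x))) {s : Q.Input V} {c₂ : ℝ} (hc : 0 < c₂)
    {d₀ : X₁ → X₂ → ℝ} {P : BYP X₁ X₂ Y} (h : IsDualBYP Q g s c₂ d₀ P) (x₁ : X₁) (x₂ : X₂)
    (y : Y) :
    P.dist x₁ x₂ y = (c₂ : EReal) * negLog (Q.pairChan g (x₁, y) x₂) + (d₀ x₁ x₂ : EReal) := by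
  by_cases hx : ∃ x, (Q.f x, g x) = (x₁, y)
  · obtain ⟨x, hx⟩ := hx
    obtain ⟨rfl, rfl⟩ := Prod.mk.inj hx
    rw [h.2.1, SBC.pairChan_apply hg]
  · push Not at hx
    rw [h.2.2.1 x₁ x₂ y hx, SBC.pairChan_eq_zero hx, Pi.zero_apply, negLog_zero,
      EReal.coe_mul_top_add hc]

theorem exists_isDualBYP (Q : SBC X X₁ X₂) {g : X → Y}
    (hg : Function.Injective (fun x => (Q.f x, g x))) (s : Q.Input V) {c₂ : ℝ} (hc : 0 < c₂)
    (d₀ : X₁ → X₂ → ℝ) : ∃ P : BYP X₁ X₂ Y, IsDualBYP Q g s c₂ d₀ P := by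
  let dist : X₁ → X₂ → Y → EReal := fun x₁ x₂ y =>
    (c₂ : EReal) * negLog (Q.pairChan g (x₁, y) x₂) + (d₀ x₁ x₂ : EReal)
  obtain ⟨D, hD⟩ : ∃ D : ℝ,
      (D : EReal) = expect s.joint (fun ω => dist (Q.f ω.2.1) ω.2.2 (g ω.2.1)) := by
    -- The expectation is finite because transitions of positive probability have a nonzero channel
    -- entry.
    refine ⟨_, (expect_eq_coe (k := fun ω => c₂ * -Real.log (Q.chan ω.2.1 ω.2.2)
      + d₀ (Q.f ω.2.1) ω.2.2) fun ω hω => ?_).symm⟩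
    simp only [dist]
    rw [SBC.pairChan_apply hg, negLog_of_ne_zero (right_ne_zero_of_mul hω), EReal.coe_add,
      EReal.coe_mul]
  refine ⟨⟨law s.joint (fun ω => (Q.f ω.2.1, ω.2.2)), law_mem_stdSimplex s.joint_mem _, dist,
    fun x₁ x₂ y => EReal.coe_mul_add_ne_bot hc ?_ _, D, Q.graph⟩, rfl, fun x x₂ => ?_,
    fun x₁ x₂ y hx => ?_, hD, rfl⟩
  · exact ((EReal.bot_lt_zero).trans_le (negLog_nonneg (SBC.pairChan_nonneg hg _ _)
      (SBC.pairChan_le_one hg _ _))).ne'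
  · simp only [dist, SBC.pairChan_apply hg]
  · simp only [dist]
    rw [SBC.pairChan_eq_zero hx, Pi.zero_apply, negLog_zero, EReal.coe_mul_top_add hc]

theorem IsDualBYP.dist_nonneg {Q : SBC X X₁ X₂} {g : X → Y}
    (hg : Function.Injective (fun x => (Q.f x, g x))) {s : Q.Input V} {c₂ : ℝ} (hc : 0 < c₂)
    {d₀ : X₁ → X₂ → ℝ} {P : BYP X₁ X₂ Y} (h : IsDualBYP Q g s c₂ d₀ P)
    (hd : ∀ x₁ x₂, 0 ≤ d₀ x₁ x₂) (x₁ : X₁) (x₂ : X₂) (y : Y) : 0 ≤ P.dist x₁ x₂ y := by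
  rw [h.dist_eq hg hc]
  exact add_nonneg (mul_nonneg (EReal.coe_nonneg.2 hc.le)
    (negLog_nonneg (SBC.pairChan_nonneg hg _ _) (SBC.pairChan_le_one hg _ _)))
    (EReal.coe_nonneg.2 (hd _ _))

end DualDistortion

/-! ### The two problems and their duals -/

section Problems

variable {X X₁ X₂ Y : Type*} [Fintype X] [Fintype X₁] [Fintype X₂] [Fintype Y]
  {V : Type} [Fintype V]

namespace BYP.Test

theorem joint_nonneg {P : BYP X₁ X₂ Y} (t : P.Test V) (ω : X₁ × X₂ × V × Y) : 0 ≤ t.joint ω :=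
  mul_nonneg (mul_nonneg (P.source_mem.1 _) ((t.pV_cond _).1 _)) ((t.pY_cond _).1 _)

theorem law_source {P : BYP X₁ X₂ Y} (t : P.Test V) :
    law t.joint (fun ω => (ω.1, ω.2.1)) = P.source := by
  classical
  funext ⟨a, b⟩
  have : ∀ x₁ x₂, ∑ v, ∑ y, t.joint (x₁, x₂, v, y) = P.source (x₁, x₂) := fun x₁ x₂ => by
    simp only [joint, ← Finset.mul_sum, (t.pY_cond _).2, mul_one, (t.pV_cond _).2]
  simp only [law, Fintype.sum_prod_type]
  rw [Finset.sum_eq_single a (fun x₁ _ h => by simp [h]) (by simp),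
    Finset.sum_eq_single b (fun x₂ _ h => by simp [h]) (by simp)]
  simpa using this a b

theorem joint_mem {P : BYP X₁ X₂ Y} (t : P.Test V) : t.joint ∈ stdSimplex ℝ (X₁ × X₂ × V × Y) :=
  ⟨t.joint_nonneg, by
    rw [← sum_law t.joint (fun ω => (ω.1, ω.2.1)), law_source, P.source_mem.2]⟩

end BYP.Test

/-! ### Equal joint laws -/

theorem SameJoint.sumRate_eq {P : BYP X₁ X₂ Y} {Q : SBC X X₁ X₂} {g : X → Y} {t : P.Test V}
    {s : Q.Input V} (h : SameJoint g t s) : t.sumRate = s.sumRate := by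
  unfold SameJoint at h
  simp only [BYP.Test.sumRate, SBC.Input.sumRate, h, mutualInfo, entropy_law]

/-- At the optimal sum-rate, $R_1+R_2'=R_1'+R_2=H(X_1|V)+I(V;X_2)$, so $R_1'\ge H(X_1|V)$ is
equivalent to $R_2\le I(V;X_2)$. By $X_1\to X_2\to V$ the same number is $H(X_1)+I(V;X_2|X_1)$, so
$R_2'\ge I(V;X_2|X_1)$ is equivalent to $R_1\le H(X_1)$. Both sum constraints hold with equality. -/
theorem SameJoint.sameCorrelation {P : BYP X₁ X₂ Y} {Q : SBC X X₁ X₂} {g : X → Y} {t : P.Test V}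
    {s : Q.Input V} (h : SameJoint g t s) {strict : Prop} {capB capS : ℕ∞}
    (hG : P.graph = Q.graph)
    (hM : IsMarkov t.joint (fun ω => ω.1) (fun ω => ω.2.1) (fun ω => ω.2.2.1))
    (hP : P.optSumRate strict capB = t.sumRate) (hQ : Q.optSumRate strict capS = t.sumRate) :
    SameCorrelation strict capB capS t s := by
  have hlaw : law s.joint (fun ω => (Q.f ω.2.1, ω.1)) = law t.joint (fun ω => (ω.1, ω.2.2.1)) := by
    rw [show t.joint = _ from h, law_law]
  refine ⟨hG, fun G ε n M₁ M₂ c₁ c₂ b₁ b₂ => by rw [hlaw], fun R₁ R₂ R₁' R₂' => ?_⟩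
  have hS : s.InRegion R₁ R₂ R₁' R₂' ↔
      0 ≤ R₁' ∧ R₁' ≤ R₁ ∧ 0 ≤ R₂' ∧ R₂' ≤ R₂ ∧
      R₁ ≤ entropy t.joint (fun ω => ω.1) ∧
      R₂ ≤ mutualInfo t.joint (fun ω => ω.2.2.1) (fun ω => ω.2.1) ∧
      R₁ + R₂' = R₁' + R₂ ∧
      R₁ + R₂' ≤ condEntropy t.joint (fun ω => ω.1) (fun ω => ω.2.2.1)
        + mutualInfo t.joint (fun ω => ω.2.2.1) (fun ω => ω.2.1) := by
    rw [show t.joint = _ from h]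
    simp only [SBC.Input.InRegion, condEntropy, mutualInfo, entropy_law]
  rw [hP, hQ, hS]
  have e := hM.entropy_eq t.joint_nonneg
  have c1 : entropy t.joint (fun ω => (ω.2.2.1, ω.2.1))
      = entropy t.joint (fun ω => (ω.2.1, ω.2.2.1)) :=
    entropy_congr fun ω ω' => by simp only [Prod.mk.injEq]; tauto
  have c2 : entropy t.joint (fun ω => (ω.2.2.1, ω.1))
      = entropy t.joint (fun ω => (ω.1, ω.2.2.1)) :=
    entropy_congr fun ω ω' => by simp only [Prod.mk.injEq]; tauto
  have c3 : entropy t.joint (fun ω => (ω.2.2.1, ω.2.1, ω.1))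
      = entropy t.joint (fun ω => (ω.1, ω.2.1, ω.2.2.1)) :=
    entropy_congr fun ω ω' => by simp only [Prod.mk.injEq]; tauto
  have c4 : entropy t.joint (fun ω => (ω.2.1, ω.1)) = entropy t.joint (fun ω => (ω.1, ω.2.1)) :=
    entropy_congr fun ω ω' => by simp only [Prod.mk.injEq]; tauto
  simp only [BYP.Test.InRegion, BYP.Test.sumRate, condEntropy, condMutualInfo, mutualInfo]
  constructor
  · rintro ⟨⟨h1, h2, h3, h4, h5, h6, h7, h8⟩, h9⟩
    exact ⟨⟨h1, h2, h3, h4, by linarith, by linarith, h7, by linarith⟩, h9⟩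
  · rintro ⟨⟨h1, h2, h3, h4, h5, h6, h7, h8⟩, h9⟩
    exact ⟨⟨h1, h2, h3, h4, by linarith, by linarith, h7, by linarith⟩, h9⟩

theorem BYP.Test.Optimal.optSumRate_eq {P : BYP X₁ X₂ Y} {t : P.Test V} {strict : Prop}
    {cap : ℕ∞} (h : t.Optimal strict cap) : P.optSumRate strict cap = t.sumRate :=
  h.2.csInf_eq

theorem SBC.Input.Optimal.optSumRate_eq {Q : SBC X X₁ X₂} {s : Q.Input V} {strict : Prop}
    {cap : ℕ∞} (h : s.Optimal strict cap) : Q.optSumRate strict cap = s.sumRate :=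
  h.2.csSup_eq

/-! ### The dual broadcast channel -/

-- Given an input, $X_1$ is deterministic, so the divergence collapses to a sum over $x_2$.
open Classical in
theorem relEntropy_fiber_eq_coe {q : X₁ × X₂ → ℝ} {k : X₂ → ℝ} {x₁ : X₁}
    (h : ∀ x₂, k x₂ ≠ 0 → q (x₁, x₂) ≠ 0) :
    relEntropy (fun z : X₁ × X₂ => if z.1 = x₁ then k z.2 else 0) q
      = ((∑ x₂, k x₂ * Real.log (k x₂ / q (x₁, x₂)) : ℝ) : EReal) := by
  rw [relEntropy_eq_coe, Fintype.sum_prod_type]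
  · simp only [ite_mul, zero_mul]
    rw [Finset.sum_eq_single x₁ (fun b _ hb => by simp [hb]) (fun hx => (hx (Finset.mem_univ _)).elim)]
    simp
  · rintro ⟨a, b⟩ hab
    by_cases ha : a = x₁
    · subst ha
      exact h b (by simpa using hab)
    · simp [ha] at hab

open Classical in
theorem fiber_mem_stdSimplex {k : X₂ → ℝ} (hk : k ∈ stdSimplex ℝ X₂) (x₁ : X₁) :
    (fun z : X₁ × X₂ => if z.1 = x₁ then k z.2 else 0) ∈ stdSimplex ℝ (X₁ × X₂) := by
  refine ⟨fun z => ?_, ?_⟩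
  · dsimp only
    split_ifs
    · exact hk.1 _
    · exact le_rfl
  · rw [Fintype.sum_prod_type, Finset.sum_eq_single x₁ (fun b _ hb => by simp [hb])
      (fun hx => (hx (Finset.mem_univ _)).elim)]
    simpa using hk.2

open Classical in
/-- If the cost is the relative entropy cost for the source `q`, a finite expected cost is
`c₁ (E[-log q(X₁,X₂)] - H(X₂|X)) + θ`. -/
theorem SBC.Input.expect_relEntropy_cost {Q : SBC X X₁ X₂} {q : X₁ × X₂ → ℝ} {c₁ θ : ℝ}
    (hc : 0 < c₁)
    (hcost : ∀ x, Q.cost x = (c₁ : EReal) *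
      relEntropy (fun z : X₁ × X₂ => if z.1 = Q.f x then Q.chan x z.2 else 0) q + (θ : EReal))
    (s : Q.Input V) {w : ℝ} (hw : expect s.joint (fun ω => Q.cost ω.2.1) ≤ (w : EReal)) :
    (∀ ω, s.joint ω ≠ 0 → q (Q.f ω.2.1, ω.2.2) ≠ 0) ∧
    expect s.joint (fun ω => Q.cost ω.2.1)
      = ((c₁ * (∑ ω, s.joint ω * -Real.log (q (Q.f ω.2.1, ω.2.2))
          + entropy s.joint (fun ω => ω.2.1) - entropy s.joint (fun ω => (ω.2.1, ω.2.2))) + θ : ℝ) :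
        EReal) := by
  have hfin : ∀ ω, s.joint ω ≠ 0 → Q.cost ω.2.1 ≠ ⊤ := fun ω hω =>
    ne_top_of_expect_le s.joint_nonneg (fun ω => Q.cost_ne_bot _) hw hω
  -- An output outside the support of `q` would make the relative entropy, hence the cost of a used
  -- input, infinite.
  have hq : ∀ ω, s.joint ω ≠ 0 → ∀ x₂, Q.chan ω.2.1 x₂ ≠ 0 → q (Q.f ω.2.1, x₂) ≠ 0 := by
    intro ω hω x₂ hx₂ h0
    refine hfin ω hω ?_
    rw [hcost, relEntropy_eq_top (a := (Q.f ω.2.1, x₂)) (by simpa using hx₂) h0,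
      EReal.coe_mul_top_add hc]
  have hq' : ∀ ω, s.joint ω ≠ 0 → q (Q.f ω.2.1, ω.2.2) ≠ 0 := fun ω hω =>
    hq ω hω _ (right_ne_zero_of_mul hω)
  refine ⟨hq', ?_⟩
  rw [expect_eq_coe (k := fun ω => c₁ * (∑ x₂, Q.chan ω.2.1 x₂ *
    Real.log (Q.chan ω.2.1 x₂ / q (Q.f ω.2.1, x₂))) + θ) fun ω hω => by
      rw [hcost, relEntropy_fiber_eq_coe (hq ω hω), EReal.coe_add, EReal.coe_mul]]
  congr 1
  have h1 := s.sum_joint_mul_sum_channel fun x x₂ => Real.log (Q.chan x x₂ / q (Q.f x, x₂))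
  have h2 := entropy_prod_sub_eq s.joint_nonneg (A := fun ω => ω.2.1) (B := fun ω => ω.2.2)
    s.law_channel
  have h3 : ∑ ω, s.joint ω * Real.log (Q.chan ω.2.1 ω.2.2 / q (Q.f ω.2.1, ω.2.2))
      = ∑ ω, s.joint ω * -Real.log (q (Q.f ω.2.1, ω.2.2))
        - ∑ ω, s.joint ω * -Real.log (Q.chan ω.2.1 ω.2.2) := by
    rw [← Finset.sum_sub_distrib]
    refine Finset.sum_congr rfl fun ω _ => ?_
    by_cases hω : s.joint ω = 0
    · simp [hω]
    rw [Real.log_div (right_ne_zero_of_mul hω) (hq' ω hω)]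
    ring
  have h4 : ∑ ω, s.joint ω * (c₁ * (∑ x₂, Q.chan ω.2.1 x₂ *
      Real.log (Q.chan ω.2.1 x₂ / q (Q.f ω.2.1, x₂))) + θ)
      = c₁ * (∑ ω, s.joint ω * ∑ x₂, Q.chan ω.2.1 x₂ *
      Real.log (Q.chan ω.2.1 x₂ / q (Q.f ω.2.1, x₂))) + (∑ ω, s.joint ω) * θ := by
    rw [Finset.mul_sum, Finset.sum_mul, ← Finset.sum_add_distrib]
    exact Finset.sum_congr rfl fun ω _ => by ring
  rw [h4, s.joint_mem.2, h1, h3, ← h2]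
  ring

theorem exists_isDualSBC (P : BYP X₁ X₂ Y) (t : P.Test V) {c₁ : ℝ} (hc : 0 < c₁) (θ : ℝ) :
    ∃ Q : SBC (X₁ × Y) X₁ X₂, IsDualSBC P t c₁ θ Q := by
  classical
  obtain ⟨ω₀, -⟩ := exists_ne_zero_of_mem_stdSimplex t.joint_mem
  have : Nonempty X₂ := ⟨ω₀.2.1⟩
  obtain ⟨K, hK, hlaw⟩ := exists_condDist t.joint_nonneg (fun ω => (ω.1, ω.2.2.2))
    (fun ω => ω.2.1)
  let cost : X₁ × Y → EReal := fun x => (c₁ : EReal) *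
    relEntropy (fun z : X₁ × X₂ => if z.1 = x.1 then K x z.2 else 0) P.source + (θ : EReal)
  obtain ⟨W, hW⟩ : ∃ W : ℝ,
      (W : EReal) = expect (law t.joint (fun ω => (ω.1, ω.2.2.2))) cost := by
    refine ⟨_, (expect_eq_coe (k := fun x => c₁ * (∑ x₂, K x x₂ *
      Real.log (K x x₂ / P.source (x.1, x₂))) + θ) fun x hx => ?_).symm⟩
    -- For an input of positive probability such an $x_2$ occurs jointly with it under $p^*$, whose
    -- $(X_1,X_2)$-marginal is the source.
    have : ∀ x₂, K x x₂ ≠ 0 → P.source (x.1, x₂) ≠ 0 := by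
      intro x₂ hx₂
      obtain ⟨ω, hω, he⟩ := exists_of_law_ne_zero ((hlaw x x₂).trans_ne (mul_ne_zero hx hx₂))
      obtain ⟨rfl, rfl⟩ := Prod.mk.inj he
      exact left_ne_zero_of_mul (left_ne_zero_of_mul hω)
    simp only [cost]
    rw [relEntropy_fiber_eq_coe this, EReal.coe_add, EReal.coe_mul]
  exact ⟨⟨Prod.fst, K, hK, cost, fun x => EReal.coe_mul_add_ne_bot hc (relEntropy_ne_bot _ _) θ,
    W, P.graph⟩, fun _ => rfl, hlaw, fun _ => rfl, hW, rfl⟩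

theorem IsDualSBC.cost_nonneg {P : BYP X₁ X₂ Y} {t : P.Test V} {c₁ θ : ℝ}
    {Q : SBC (X₁ × Y) X₁ X₂} (h : IsDualSBC P t c₁ θ Q) (hc : 0 < c₁) (hθ : 0 ≤ θ) (x : X₁ × Y) :
    0 ≤ Q.cost x := by
  classical
  rw [h.2.2.1]
  exact add_nonneg (mul_nonneg (EReal.coe_nonneg.2 hc.le)
    (relEntropy_nonneg (fiber_mem_stdSimplex (Q.chan_cond x) _) P.source_mem))
    (EReal.coe_nonneg.2 hθ)

theorem exists_inducedInput {P : BYP X₁ X₂ Y} (t : P.Test V) (Q : SBC (X₁ × Y) X₁ X₂) :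
    ∃ s : Q.Input V, InducedInput t s := by
  obtain ⟨ω₀, -⟩ := exists_ne_zero_of_mem_stdSimplex t.joint_mem
  have : Nonempty (X₁ × Y) := ⟨(ω₀.1, ω₀.2.2.2)⟩
  obtain ⟨K, hK, hlaw⟩ := exists_condDist t.joint_nonneg (fun ω => ω.2.2.1)
    (fun ω => (ω.1, ω.2.2.2))
  exact ⟨⟨law t.joint (fun ω => ω.2.2.1), K, law_mem_stdSimplex t.joint_mem _, hK⟩,
    fun _ => rfl, hlaw⟩

/-- The chain $V\to X\to X_2$ factors $p^*$ as $p^*(v)p^*(x|v)p^*(x_2|x)$, whichever versions are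
chosen. -/
theorem InducedInput.sameJoint {P : BYP X₁ X₂ Y} {t : P.Test V} {c₁ θ : ℝ}
    {Q : SBC (X₁ × Y) X₁ X₂} (hQ : IsDualSBC P t c₁ θ Q)
    (hM : IsMarkov t.joint (fun ω => ω.2.2.1) (fun ω => (ω.1, ω.2.2.2)) (fun ω => (ω.1, ω.2.1)))
    {s : Q.Input V} (hs : InducedInput t s) : SameJoint Prod.snd t s := by
  funext ⟨x₁, x₂, v, y⟩
  have h1 : law s.joint (fun ω => (Q.f ω.2.1, ω.2.2, ω.1, ω.2.1.2)) (x₁, x₂, v, y)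
      = s.joint (v, (x₁, y), x₂) := by
    rw [← law_apply_of_injective s.joint Function.injective_id (v, (x₁, y), x₂)]
    refine law_congr fun ω => ?_
    simp only [hQ.1, id, Prod.ext_iff]
    tauto
  have h2 : law t.joint (fun ω => (ω.2.2.1, (ω.1, ω.2.2.2), ω.2.1)) (v, (x₁, y), x₂)
      = t.joint (x₁, x₂, v, y) := by
    rw [← law_apply_of_injective t.joint Function.injective_id (x₁, x₂, v, y)]
    refine law_congr fun ω => ?_
    simp only [id, Prod.ext_iff]
    tauto
  have h3 := (hM.map_right fun _ z => z.2).law_eq t.joint_nonneg hQ.2.1 v (x₁, y) x₂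
  rw [h1, ← h2, h3, hs.2, SBC.Input.joint, hs.1]

/-- For a competitor $s'$: sum-rate $\le H'(X_1,X_2)-H'(X_2|X)\le E'[-\log\bar p]-H'(X_2|X)\le
E[-\log\bar p]-H(X_2|X)$, by the Markov bound, Gibbs and the cost constraint. At `s` all of these
are equalities. -/
theorem isDualSBC_optimal {P : BYP X₁ X₂ Y} {t : P.Test V} {c₁ θ : ℝ} (hc : 0 < c₁)
    {Q : SBC (X₁ × Y) X₁ X₂} (hQ : IsDualSBC P t c₁ θ Q) {strict : Prop} {capB capS : ℕ∞}
    (ht : t.Feasible strict capB) (hV : (Fintype.card V : ℕ∞) ≤ capS)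
    (hM : IsMarkov t.joint (fun ω => ω.2.2.1) (fun ω => (ω.1, ω.2.2.2)) (fun ω => (ω.1, ω.2.1)))
    {s : Q.Input V} (hs : InducedInput t s) : s.Optimal strict capS := by
  have hJ := hs.sameJoint hQ hM
  have hJ' : t.joint = law s.joint (fun ω => (Q.f ω.2.1, ω.2.2, ω.1, ω.2.1.2)) := hJ
  have hf : Q.f = Prod.fst := funext hQ.1
  have hW : expect s.joint (fun ω => Q.cost ω.2.1) = (Q.W : EReal) := by
    rw [hQ.2.2.2.1, hJ', law_law, expect_law s.joint_nonneg]
    simp only [hf, Prod.mk.eta]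
  obtain ⟨-, -, hM1, hM2, hM3⟩ := ht
  -- The channel input is the pair $(X_1,\hat X_2)$, and $X_1$ is already part of the middle
  -- variable.
  have hM2' := hM2.map_right fun b y => (b.1, y)
  rw [hJ', isMarkov_law_iff] at hM hM1 hM2'
  have hfeas : s.Feasible strict capS := by
    refine ⟨hV, hW.le, ?_, ?_, fun h => ?_⟩
    · simpa only [hf, Prod.mk.eta] using hM
    · simpa only [hf, Prod.mk.eta] using hM2'
    · have := hM3 h
      rw [hJ', isMarkov_law_iff] at this
      simpa only [hf, Prod.mk.eta] using this
  have hsource : law s.joint (fun ω => (Q.f ω.2.1, ω.2.2)) = P.source := by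
    rw [← t.law_source, hJ', law_law]
  refine ⟨hfeas, ⟨V, _, s, hfeas, rfl⟩, ?_⟩
  rintro r ⟨V', _, s', hs', rfl⟩
  have hs1 := sumRate_eq_of_isMarkov s.joint_nonneg hfeas.2.2.1 hfeas.2.2.2.1 hM1
  have hs2 := sumRate_le_of_isMarkov s'.joint_nonneg hs'.2.2.1 hs'.2.2.2.1
  obtain ⟨-, he⟩ := s.expect_relEntropy_cost hc hQ.2.2.1 hW.le
  obtain ⟨hac, he'⟩ := s'.expect_relEntropy_cost hc hQ.2.2.1 hs'.2.1
  have hle := hs'.2.1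
  -- The cost of `s` meets `W` exactly, so $\theta$ and $c_1>0$ cancel.
  rw [he', ← hW, he, EReal.coe_le_coe_iff, add_le_add_iff_right, mul_le_mul_iff_right₀ hc] at hle
  have hG := entropy_le_crossEntropy s'.joint_nonneg (fun ω => (Q.f ω.2.1, ω.2.2))
    P.source_mem.1 (by rw [P.source_mem.2, s'.joint_mem.2]) hac
  have hE := entropy_eq_sum s.joint (fun ω => (Q.f ω.2.1, ω.2.2))
  rw [hsource] at hE
  unfold SBC.Input.sumRate
  linarith

/-! ### The dual Berger–Yeung problem -/

/-- If the distortion is the logarithmic distortion for `K`, a finite expected distortion is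
`c₂ E[-log K(X₂|X₁,X̂₂)] + E[d₀(X₁,X₂)]`. -/
theorem BYP.Test.expect_negLog_dist {P : BYP X₁ X₂ Y} {K : X₁ × Y → X₂ → ℝ} {c₂ : ℝ} (hc : 0 < c₂)
    {d₀ : X₁ → X₂ → ℝ}
    (hdist : ∀ x₁ x₂ y, P.dist x₁ x₂ y
      = (c₂ : EReal) * negLog (K (x₁, y) x₂) + (d₀ x₁ x₂ : EReal))
    (t : P.Test V) {w : ℝ}
    (hw : expect t.joint (fun ω => P.dist ω.1 ω.2.1 ω.2.2.2) ≤ (w : EReal)) :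
    (∀ ω, t.joint ω ≠ 0 → K (ω.1, ω.2.2.2) ω.2.1 ≠ 0) ∧
    expect t.joint (fun ω => P.dist ω.1 ω.2.1 ω.2.2.2)
      = ((c₂ * (∑ ω, t.joint ω * -Real.log (K (ω.1, ω.2.2.2) ω.2.1))
        + ∑ z, P.source z * d₀ z.1 z.2 : ℝ) : EReal) := by
  have hK : ∀ ω, t.joint ω ≠ 0 → K (ω.1, ω.2.2.2) ω.2.1 ≠ 0 := by
    intro ω hω h0
    refine ne_top_of_expect_le t.joint_nonneg (fun ω => P.dist_ne_bot _ _ _) hw hω ?_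
    rw [hdist, h0, negLog_zero, EReal.coe_mul_top_add hc]
  refine ⟨hK, ?_⟩
  rw [expect_eq_coe (k := fun ω => c₂ * -Real.log (K (ω.1, ω.2.2.2) ω.2.1) + d₀ ω.1 ω.2.1)
    fun ω hω => by rw [hdist, negLog_of_ne_zero (hK ω hω), EReal.coe_add, EReal.coe_mul]]
  congr 1
  rw [← t.law_source, sum_law_mul t.joint (fun ω => (ω.1, ω.2.1)) fun z => d₀ z.1 z.2,
    Finset.mul_sum, ← Finset.sum_add_distrib]
  exact Finset.sum_congr rfl fun ω _ => by ring

theorem exists_inducedTest {Q : SBC X X₁ X₂} (g : X → Y) (s : Q.Input V) (P : BYP X₁ X₂ Y) :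
    ∃ t : P.Test V, InducedTest g s t := by
  obtain ⟨ω₀, -⟩ := exists_ne_zero_of_mem_stdSimplex s.joint_mem
  have : Nonempty V := ⟨ω₀.1⟩
  have : Nonempty Y := ⟨g ω₀.2.1⟩
  obtain ⟨K, hK, hlaw⟩ := exists_condDist s.joint_nonneg (fun ω => ω.2.2) (fun ω => ω.1)
  obtain ⟨L, hL, hlaw'⟩ := exists_condDist s.joint_nonneg (fun ω => (Q.f ω.2.1, ω.1))
    (fun ω => g ω.2.1)
  exact ⟨⟨K, L, hK, hL⟩, hlaw, fun x₁ v y => hlaw' (x₁, v) y⟩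

/-- The two chains factor the law as $p^*(x_1,x_2)p^*(v|x_2)p^*(\hat x_2|x_1,v)$. -/
theorem InducedTest.sameJoint {Q : SBC X X₁ X₂} {g : X → Y} {s : Q.Input V} {P : BYP X₁ X₂ Y}
    (hP : P.source = law s.joint (fun ω => (Q.f ω.2.1, ω.2.2)))
    (hM : IsMarkov s.joint (fun ω => Q.f ω.2.1) (fun ω => ω.2.2) (fun ω => ω.1))
    (hM' : IsMarkov s.joint (fun ω => ω.2.2) (fun ω => (Q.f ω.2.1, ω.1)) (fun ω => ω.2.1))
    {t : P.Test V} (ht : InducedTest g s t) : SameJoint g t s := by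
  funext ⟨x₁, x₂, v, y⟩
  have h1 := (hM'.map_right fun _ x => g x).law_eq s.joint_nonneg
    (K := t.pY) (fun z y => ht.2 z.1 z.2 y) x₂ (x₁, v) y
  have h2 := hM.law_eq s.joint_nonneg ht.1 x₁ x₂ v
  have h3 : law s.joint (fun ω => (Q.f ω.2.1, ω.2.2, ω.1, g ω.2.1)) (x₁, x₂, v, y)
      = law s.joint (fun ω => (ω.2.2, (Q.f ω.2.1, ω.1), g ω.2.1)) (x₂, (x₁, v), y) :=
    law_congr fun ω => by simp only [Prod.mk.injEq]; tauto
  have h4 : law s.joint (fun ω => (ω.2.2, (Q.f ω.2.1, ω.1))) (x₂, (x₁, v))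
      = law s.joint (fun ω => (Q.f ω.2.1, ω.2.2, ω.1)) (x₁, x₂, v) :=
    law_congr fun ω => by simp only [Prod.mk.injEq]; tauto
  rw [h3, h1, h4, h2, ← hP, BYP.Test.joint]

/-- For a competitor $t'$: sum-rate $\ge H(X_1,X_2)-H'(X_2|X)\ge H(X_1,X_2)-E'[-\log\bar
p(X_2|X)]\ge H(X_1,X_2)-E[-\log\bar p(X_2|X)]$, by the Markov bound, Gibbs and the distortion
constraint; the last expression is the sum-rate of `s`. -/
theorem isDualBYP_optimal {Q : SBC X X₁ X₂} {g : X → Y}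
    (hg : Function.Injective (fun x => (Q.f x, g x))) {s : Q.Input V} {c₂ : ℝ} (hc : 0 < c₂)
    {d₀ : X₁ → X₂ → ℝ} {P : BYP X₁ X₂ Y} (hP : IsDualBYP Q g s c₂ d₀ P) {strict : Prop}
    {capB capS : ℕ∞} (hs : s.Feasible strict capS) (hV : (Fintype.card V : ℕ∞) ≤ capB)
    (hM : IsMarkov s.joint (fun ω => Q.f ω.2.1) (fun ω => ω.2.2) (fun ω => ω.1))
    {t : P.Test V} (ht : InducedTest g s t) : t.Optimal strict capB := by
  obtain ⟨-, -, hM1, hM2, hM3⟩ := hs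
  have hJ := ht.sameJoint hP.1 hM hM2
  have hJ' : t.joint = law s.joint (fun ω => (Q.f ω.2.1, ω.2.2, ω.1, g ω.2.1)) := hJ
  have hD : expect t.joint (fun ω => P.dist ω.1 ω.2.1 ω.2.2.2) = (P.D : EReal) := by
    rw [hP.2.2.2.1, hJ', expect_law s.joint_nonneg]
  have hfeas : t.Feasible strict capB := by
    refine ⟨hV, hD.le, ?_, ?_, fun h => ?_⟩
    · rwa [hJ', isMarkov_law_iff]
    · rw [hJ', isMarkov_law_iff]
      exact hM2.map_right fun _ x => g x
    · rw [hJ', isMarkov_law_iff]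
      exact (hM3 h).map_right fun _ x => (Q.f x, g x)
  refine ⟨hfeas, ⟨V, _, t, hfeas, rfl⟩, ?_⟩
  rintro r ⟨V', _, t', ht', rfl⟩
  have hdist := hP.dist_eq hg hc
  have h1 := sumRate_eq_of_isMarkov s.joint_nonneg hM1 hM2 hM
  have h2 := le_sumRate_of_isMarkov t'.joint_nonneg ht'.2.2.1 ht'.2.2.2.1
  obtain ⟨-, he⟩ := t.expect_negLog_dist hc hdist hD.le
  obtain ⟨hac, he'⟩ := t'.expect_negLog_dist hc hdist ht'.2.1
  have hle := ht'.2.1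
  rw [he', ← hD, he, EReal.coe_le_coe_iff, add_le_add_iff_right, mul_le_mul_iff_right₀ hc] at hle
  have h3 := entropy_prod_sub_le t'.joint_nonneg (fun ω => (ω.1, ω.2.2.2)) (fun ω => ω.2.1)
    (SBC.pairChan_nonneg hg) (SBC.sum_pairChan_le_one hg) hac
  have h4 := entropy_prod_sub_eq s.joint_nonneg (A := fun ω => ω.2.1) (B := fun ω => ω.2.2)
    s.law_channel
  have h5 : ∑ ω, t.joint ω * -Real.log (Q.pairChan g (ω.1, ω.2.2.2) ω.2.1)
      = ∑ ω, s.joint ω * -Real.log (Q.chan ω.2.1 ω.2.2) := by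
    rw [hJ', sum_law_mul s.joint _ fun ω : X₁ × X₂ × V × Y =>
      -Real.log (Q.pairChan g (ω.1, ω.2.2.2) ω.2.1)]
    simp only [SBC.pairChan_apply hg]
  -- Every test has the prescribed source marginal, so this entropy does not vary.
  have h6 : entropy t'.joint (fun ω => (ω.1, ω.2.1))
      = entropy s.joint (fun ω => (Q.f ω.2.1, ω.2.2)) := by
    rw [entropy, entropy, t'.law_source, hP.1]
  rw [hJ.sumRate_eq]
  unfold SBC.Input.sumRate BYP.Test.sumRate
  linarith

end Problems

/-! ### The duality theorem -/

theorem theorem2 {X X₁ X₂ Y : Type*} [Fintype X] [Fintype X₁] [Fintype X₂] [Fintype Y]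
    {V : Type} [Fintype V] (strict : Prop) (capB capS : ℕ∞) :
    -- from the Berger–Yeung problem to the broadcast channel
    (∀ (P : BYP X₁ X₂ Y) (t : P.Test V),
      t.Optimal strict capB → (Fintype.card V : ℕ∞) ≤ capS →
      IsMarkov t.joint (fun ω => ω.2.2.1) (fun ω => (ω.1, ω.2.2.2)) (fun ω => (ω.1, ω.2.1)) →
      ∀ c₁ θ : ℝ, 0 < c₁ →
        (∃ Q : SBC (X₁ × Y) X₁ X₂, IsDualSBC P t c₁ θ Q) ∧
        ∀ Q : SBC (X₁ × Y) X₁ X₂, IsDualSBC P t c₁ θ Q →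
          (0 ≤ θ → ∀ x, 0 ≤ Q.cost x) ∧
          P.optSumRate strict capB = Q.optSumRate strict capS ∧
          (∃ s : Q.Input V, InducedInput t s) ∧
          ∀ s : Q.Input V, InducedInput t s →
            s.Optimal strict capS ∧ SameJoint Prod.snd t s ∧
            SameCorrelation strict capB capS t s) ∧
    -- from the broadcast channel to the Berger–Yeung problem
    (∀ (Q : SBC X X₁ X₂) (g : X → Y), Function.Injective (fun x => (Q.f x, g x)) →
      ∀ s : Q.Input V, s.Optimal strict capS → (Fintype.card V : ℕ∞) ≤ capB →
      IsMarkov s.joint (fun ω => Q.f ω.2.1) (fun ω => ω.2.2) (fun ω => ω.1) →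
      ∀ (c₂ : ℝ) (d₀ : X₁ → X₂ → ℝ), 0 < c₂ →
        (∃ P : BYP X₁ X₂ Y, IsDualBYP Q g s c₂ d₀ P) ∧
        ∀ P : BYP X₁ X₂ Y, IsDualBYP Q g s c₂ d₀ P →
          ((∀ x₁ x₂, 0 ≤ d₀ x₁ x₂) → ∀ x₁ x₂ y, 0 ≤ P.dist x₁ x₂ y) ∧
          Q.optSumRate strict capS = P.optSumRate strict capB ∧
          (∃ t : P.Test V, InducedTest g s t) ∧
          ∀ t : P.Test V, InducedTest g s t →
            t.Optimal strict capB ∧ SameJoint g t s ∧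
            SameCorrelation strict capB capS t s) := by
  constructor
  · intro P t ht hV hM c₁ θ hc
    refine ⟨exists_isDualSBC P t hc θ, fun Q hQ => ?_⟩
    have key : ∀ s : Q.Input V, InducedInput t s →
        s.Optimal strict capS ∧ SameJoint Prod.snd t s := fun s hs =>
      ⟨isDualSBC_optimal hc hQ ht.1 hV hM hs, hs.sameJoint hQ hM⟩
    have hopt : ∀ s : Q.Input V, InducedInput t s → Q.optSumRate strict capS = t.sumRate :=
      fun s hs => (key s hs).1.optSumRate_eq.trans (key s hs).2.sumRate_eq.symm
    obtain ⟨s₀, hs₀⟩ := exists_inducedInput t Q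
    refine ⟨fun hθ x => hQ.cost_nonneg hc hθ x, ht.optSumRate_eq.trans (hopt s₀ hs₀).symm,
      ⟨s₀, hs₀⟩, fun s hs => ⟨(key s hs).1, (key s hs).2, ?_⟩⟩
    exact (key s hs).2.sameCorrelation hQ.2.2.2.2.symm ht.1.2.2.1 ht.optSumRate_eq (hopt s hs)
  · intro Q g hg s hs hV hM c₂ d₀ hc
    refine ⟨exists_isDualBYP Q hg s hc d₀, fun P hP => ?_⟩
    have key : ∀ t : P.Test V, InducedTest g s t → t.Optimal strict capB ∧ SameJoint g t s :=
      fun t ht => ⟨isDualBYP_optimal hg hc hP hs.1 hV hM ht,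
        ht.sameJoint hP.1 hM hs.1.2.2.2.1⟩
    have hopt : ∀ t : P.Test V, InducedTest g s t → Q.optSumRate strict capS = t.sumRate :=
      fun t ht => hs.optSumRate_eq.trans (key t ht).2.sumRate_eq.symm
    obtain ⟨t₀, ht₀⟩ := exists_inducedTest g s P
    refine ⟨fun hd x₁ x₂ y => hP.dist_nonneg hg hc hd x₁ x₂ y,
      (hopt t₀ ht₀).trans (key t₀ ht₀).1.optSumRate_eq.symm, ⟨t₀, ht₀⟩,
      fun t ht => ⟨(key t ht).1, (key t ht).2, ?_⟩⟩
    exact (key t ht).2.sameCorrelation hP.2.2.2.2 (key t ht).1.1.2.2.1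
      (key t ht).1.optSumRate_eq (hopt t ht)
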